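/- **Conventions.** A subgroup $H$ of a group $K$ is *left relatively convex* if the set $K/H$ of left cosets carries a total order invariant under left multiplication by $K$. A *quasimorphism* on a group $G$ is a map $\phi\colon G\to\mathbb{R}$ for which $|\phi(g)+\phi(h)-\phi(gh)|$ is bounded over $g,h\in G$; its *defect* $D(\phi)$ is the least upper bound. It is *homogeneous* if $\phi(g^n)=n\,\phi(g)$ for all $g\in G$, $n\in\mathbb{Z}$. Let $G'$ be the commutator subgroup of $G$; for $g\in G'$ let $\mathrm{cl}(g)$ be the least $k$ such that $g$ is a product of $k$ commutators $[x,y]=xyx^{-1}y^{-1}$, and $\mathrm{scl}(g)=\lim_{n\to\infty}\mathrm{cl}(g^n)/n$. For $V=\mathbb{Z}$ or $\mathbb{R}$ with trivial action, $\mathrm{H}^2_b(G,V)$ is the group of bounded functions $f\colon G\times G\to V$ with $f(h,k)-f(gh,k)+f(g,hk)-f(g,h)=0$ modulo the functions $\delta^1u(g,h)=u(h)-u(gh)+u(g)$ with $u\colon G\to V$ bounded. A quasimorphism $\phi$ defines a class $[\delta^1\phi]\in\mathrm{H}^2_b(G,\mathbb{R})$. Let $S^1=\mathbb{R}/\mathbb{Z}$,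 and for an orientation preserving homeomorphism $f$ of $S^1$ let $\sigma_b(f)$ be its unique lift to an increasing homeomorphism of $\mathbb{R}$ that commutes with integer translations and satisfies $\sigma_b(f)(0)\in[0,1)$. The *real bounded Euler class* $\mathrm{eu}^{\mathbb{R}}_b\in\mathrm{H}^2_b(\mathrm{Homeo}^+(S^1),\mathbb{R})$ is the image, under the change of coefficients $\mathbb{Z}\to\mathbb{R}$, of the class of the bounded integral cocycle $(f,g)\mapsto\sigma_b(f)\sigma_b(g)\sigma_b(fg)^{-1}$, where $n\in\mathbb{Z}$ is identified with the translation $x\mapsto x+n$. **Theorem.** Let $A,B,C$ be groups and let $\kappa_A\colon C\to A$, $\kappa_B\colon C\to B$ be injective homomorphisms such that $\kappa_A(C)$ is left relatively convex in $A$ and $\kappa_B(C)$ is left relatively convex in $B$. Let $G=A\star_C B=(A\star B)/\langle\langle \kappa_A(c)^{-1}\kappa_B(c)\mid c\in C\rangle\rangle$ be the amalgamated free product, and let $g_0\in G$ be an element that is not conjugate in $G$ to an element of (the image of) $A$ or $B$. Then: 1. There is a homogeneous quasimorphism $\bar\phi\colon G\to\mathbb{R}$ with $\bar\phi(g_0)\ge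 1$ and $D(\bar\phi)\le 1$ that vanishes on $A$ and on $B$ and that, if $G$ is countable, is moreover induced by a circle action: there is a homomorphism $\rho\colon G\to\mathrm{Homeo}^+(S^1)$ with $[\delta^1\bar\phi]=\rho^*\mathrm{eu}^{\mathbb{R}}_b\in\mathrm{H}^2_b(G,\mathbb{R})$. 2. If $g_0\in G'$, then $\mathrm{scl}(g_0)\ge 1/2$. -/

import Mathlib

namespace AmalgamScl

/-! ### Amalgamated free products and left relatively convex subgroups -/

section Amalgam

variable {A B C : Type*} [Group A] [Group B] [Group C]

/-- The normal subgroup of the free product `A ∗ B` generated by the elements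
`κ_A(c)⁻¹ κ_B(c)`, `c ∈ C`. -/
def amalgamRel (κA : C →* A) (κB : C →* B) : Subgroup (Monoid.Coprod A B) :=
  Subgroup.normalClosure
    {x | ∃ c : C, x = (Monoid.Coprod.inl (κA c))⁻¹ * Monoid.Coprod.inr (κB c)}

instance amalgamRel_normal (κA : C →* A) (κB : C →* B) : (amalgamRel κA κB).Normal :=
  Subgroup.normalClosure_normal

/-- The amalgamated free product `A ⋆_C B`. -/
abbrev Amalgam (κA : C →* A) (κB : C →* B) : Type _ :=
  Monoid.Coprod A B ⧸ amalgamRel κA κB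

/-- The canonical homomorphism `A → A ⋆_C B`. -/
def Amalgam.inl (κA : C →* A) (κB : C →* B) : A →* Amalgam κA κB :=
  (QuotientGroup.mk' (amalgamRel κA κB)).comp Monoid.Coprod.inl

/-- The canonical homomorphism `B → A ⋆_C B`. -/
def Amalgam.inr (κA : C →* A) (κB : C →* B) : B →* Amalgam κA κB :=
  (QuotientGroup.mk' (amalgamRel κA κB)).comp Monoid.Coprod.inr

end Amalgam

/-- `H` is left relatively convex in `G`: the set `G ⧸ H` of left cosets carries a total order
that is invariant under left multiplication by `G`. -/
def LeftRelativelyConvex {G : Type*} [Group G] (H : Subgroup G) : Prop :=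
  ∃ _ : LinearOrder (G ⧸ H), ∀ (g : G) (x y : G ⧸ H), x ≤ y → g • x ≤ g • y

/-! ### Commutator length and stable commutator length -/

section Scl

variable {G : Type*} [Group G]

/-- The commutator length of `g`: the least `k` such that `g` is a product of `k` commutators
`[x, y] = x y x⁻¹ y⁻¹`. It is only meaningful for `g` in the commutator subgroup. -/
noncomputable def cl (g : G) : ℕ :=
  sInf {k : ℕ | ∃ l : List (G × G), l.length = k ∧ (l.map fun p => p.1 * p.2 * p.1⁻¹ * p.2⁻¹).prod = g}

/-- The stable commutator length `lim cl(gⁿ) / n`; by `tendsto_scl` the limit exists for every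
`g` in the commutator subgroup. -/
noncomputable def scl (g : G) : ℝ :=
  Filter.limUnder Filter.atTop fun n : ℕ => (cl (g ^ n) : ℝ) / n

theorem exists_commutator_list {g : G} (hg : g ∈ commutator G) :
    ∃ l : List (G × G), (l.map fun p => p.1 * p.2 * p.1⁻¹ * p.2⁻¹).prod = g := by
  have hg' : g ∈ Subgroup.closure (commutatorSet G) := commutator_eq_closure G ▸ hg
  clear hg
  induction hg' using Subgroup.closure_induction with
  | mem x hx =>
    obtain ⟨a, b, rfl⟩ := hx
    exact ⟨[(a, b)], by simp [commutatorElement_def]⟩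
  | one => exact ⟨[], by simp⟩
  | mul x y _ _ hx hy =>
    obtain ⟨l, hl⟩ := hx
    obtain ⟨m, hm⟩ := hy
    exact ⟨l ++ m, by simp [hl, hm]⟩
  | inv x _ hx =>
    obtain ⟨l, rfl⟩ := hx
    refine ⟨(l.map fun p => (p.2, p.1)).reverse, ?_⟩
    rw [List.prod_inv_reverse, List.map_reverse, List.map_map, List.map_map]
    congr 2
    apply List.map_congr_left
    intro p _
    simp [mul_assoc]

theorem cl_spec {g : G} (hg : g ∈ commutator G) :
    ∃ l : List (G × G), l.length = cl g ∧ (l.map fun p => p.1 * p.2 * p.1⁻¹ * p.2⁻¹).prod = g := by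
  have hne : {k : ℕ | ∃ l : List (G × G),
      l.length = k ∧ (l.map fun p => p.1 * p.2 * p.1⁻¹ * p.2⁻¹).prod = g}.Nonempty := by
    obtain ⟨l, hl⟩ := exists_commutator_list hg
    exact ⟨l.length, l, rfl, hl⟩
  exact Nat.sInf_mem hne

theorem cl_mul_le {g h : G} (hg : g ∈ commutator G) (hh : h ∈ commutator G) :
    cl (g * h) ≤ cl g + cl h := by
  obtain ⟨l, hl, hl'⟩ := cl_spec hg
  obtain ⟨m, hm, hm'⟩ := cl_spec hh
  refine Nat.sInf_le ⟨l ++ m, ?_, ?_⟩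
  · rw [List.length_append, hl, hm]
  · rw [List.map_append, List.prod_append, hl', hm']

theorem tendsto_scl {g : G} (hg : g ∈ commutator G) :
    Filter.Tendsto (fun n : ℕ => (cl (g ^ n) : ℝ) / n) Filter.atTop (nhds (scl g)) := by
  have hsub : Subadditive fun n : ℕ => (cl (g ^ n) : ℝ) := by
    intro m n
    have := cl_mul_le (pow_mem hg m) (pow_mem hg n)
    rw [← pow_add] at this
    change (cl (g ^ (m + n)) : ℝ) ≤ cl (g ^ m) + cl (g ^ n)
    exact_mod_cast this
  have hb : BddBelow (Set.range fun n : ℕ => (cl (g ^ n) : ℝ) / n) :=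
    ⟨0, by rintro _ ⟨n, rfl⟩; positivity⟩
  exact tendsto_nhds_limUnder ⟨_, hsub.tendsto_lim hb⟩

end Scl

/-! ### Quasimorphisms -/

section Quasimorphism

variable {G : Type*} [Group G]

/-- A quasimorphism `φ : G → ℝ`. -/
def IsQuasimorphism (φ : G → ℝ) : Prop :=
  ∃ D : ℝ, ∀ g h : G, |φ g + φ h - φ (g * h)| ≤ D

/-- A homogeneous quasimorphism `φ : G → ℝ`. -/
structure IsHomogeneousQuasimorphism (φ : G → ℝ) : Prop where
  isQuasimorphism : IsQuasimorphism φ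
  map_zpow : ∀ (g : G) (n : ℤ), φ (g ^ n) = n * φ g

/-- The defect `D(φ)`: the infimum of all admissible constants. -/
noncomputable def defect (φ : G → ℝ) : ℝ :=
  sInf {D : ℝ | ∀ g h : G, |φ g + φ h - φ (g * h)| ≤ D}

end Quasimorphism

/-! ### Second bounded cohomology with trivial coefficients -/

section BoundedCohomology

variable (G : Type*) [Group G] (V : Type*) [NormedAddCommGroup V]

/-- Bounded inhomogeneous `2`-cocycles of `G` with values in the trivial module `V`
(used for `V = ℤ` and `V = ℝ`). -/
def boundedCocycles : AddSubgroup (G → G → V) where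
  carrier := {f | (∃ M : ℝ, ∀ g h, ‖f g h‖ ≤ M) ∧
    ∀ g h k, f h k - f (g * h) k + f g (h * k) - f g h = 0}
  zero_mem' := ⟨⟨0, by simp⟩, by simp⟩
  add_mem' := by
    rintro f f' ⟨⟨M, hM⟩, hf⟩ ⟨⟨M', hM'⟩, hf'⟩
    refine ⟨⟨M + M', fun g h => (norm_add_le _ _).trans (add_le_add (hM g h) (hM' g h))⟩, ?_⟩
    intro g h k
    have := congrArg₂ (· + ·) (hf g h k) (hf' g h k)
    simp only [add_zero] at this
    rw [← this]
    simp only [Pi.add_apply]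
    abel
  neg_mem' := by
    rintro f ⟨⟨M, hM⟩, hf⟩
    refine ⟨⟨M, fun g h => by simpa using hM g h⟩, ?_⟩
    intro g h k
    have := congrArg Neg.neg (hf g h k)
    rw [neg_zero] at this
    rw [← this]
    simp only [Pi.neg_apply]
    abel

/-- The coboundary `δ¹`, `(δ¹ u)(g, h) = u(h) - u(gh) + u(g)`. -/
def coboundary : (G → V) →+ (G → G → V) where
  toFun u := fun g h => u h - u (g * h) + u g
  map_zero' := by ext; simp
  map_add' u v := by ext g h; simp only [Pi.add_apply]; abel

/-- Bounded functions `G → V`. -/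
def boundedCochains : AddSubgroup (G → V) where
  carrier := {u | ∃ M : ℝ, ∀ g, ‖u g‖ ≤ M}
  zero_mem' := ⟨0, by simp⟩
  add_mem' := by
    rintro u v ⟨M, hM⟩ ⟨N, hN⟩
    exact ⟨M + N, fun g => (norm_add_le _ _).trans (add_le_add (hM g) (hN g))⟩
  neg_mem' := by
    rintro u ⟨M, hM⟩
    exact ⟨M, fun g => by simpa using hM g⟩

/-- `2`-coboundaries of bounded `1`-cochains. -/
def boundedCoboundaries : AddSubgroup (G → G → V) :=
  (boundedCochains G V).map (coboundary G V)

/-- The second bounded cohomology group `H²_b(G, V) = Z²_b(G, V) / B²_b(G, V)`. -/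
abbrev H2b : Type _ :=
  boundedCocycles G V ⧸ (boundedCoboundaries G V).addSubgroupOf (boundedCocycles G V)

variable {G V}

/-- The class of a bounded cocycle. -/
def H2b.mk (f : G → G → V) (hf : f ∈ boundedCocycles G V) : H2b G V :=
  QuotientAddGroup.mk ⟨f, hf⟩

/-- Pull-back of bounded cocycles along a homomorphism `G → H`. -/
def pullbackCocycle {H : Type*} [Group H] (ρ : G →* H) :
    boundedCocycles H V →+ boundedCocycles G V where
  toFun f := ⟨fun g h => f.1 (ρ g) (ρ h), by
    obtain ⟨⟨M, hM⟩, hf⟩ := f.2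
    refine ⟨⟨M, fun g h => hM _ _⟩, fun g h k => ?_⟩
    simpa only [map_mul] using hf (ρ g) (ρ h) (ρ k)⟩
  map_zero' := rfl
  map_add' _ _ := rfl

/-- The map `ρ^* : H²_b(H, V) → H²_b(G, V)` induced by a homomorphism `ρ : G → H`. -/
def H2b.pullback {H : Type*} [Group H] (ρ : G →* H) : H2b H V →+ H2b G V :=
  QuotientAddGroup.map _ _ (pullbackCocycle ρ) (by
    rintro f ⟨u, ⟨M, hM⟩, hu⟩
    refine ⟨fun g => u (ρ g), ⟨M, fun g => hM _⟩, ?_⟩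
    ext g h
    have := congrFun (congrFun hu (ρ g)) (ρ h)
    simpa only [coboundary, pullbackCocycle, AddMonoidHom.coe_mk, ZeroHom.coe_mk, map_mul,
      AddSubgroup.coe_subtype] using this)

/-- Integral bounded cocycles, seen as real ones. -/
def realCocycle : boundedCocycles G ℤ →+ boundedCocycles G ℝ where
  toFun f := ⟨fun g h => (f.1 g h : ℝ), by
    obtain ⟨⟨M, hM⟩, hf⟩ := f.2
    refine ⟨⟨M, fun g h => by rw [Int.norm_cast_real]; exact hM g h⟩, fun g h k => ?_⟩
    have := congrArg (Int.cast : ℤ → ℝ) (hf g h k)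
    push_cast at this
    exact this⟩
  map_zero' := by ext; simp
  map_add' _ _ := by ext; simp

/-- The change of coefficients map `H²_b(G, ℤ) → H²_b(G, ℝ)`. -/
def H2b.changeOfCoefficients : H2b G ℤ →+ H2b G ℝ :=
  QuotientAddGroup.map _ _ realCocycle (by
    rintro f ⟨u, ⟨M, hM⟩, hu⟩
    refine ⟨fun g => (u g : ℝ), ⟨M, fun g => by rw [Int.norm_cast_real]; exact hM g⟩, ?_⟩
    ext g h
    have := congrFun (congrFun hu g) h
    simp only [coboundary, AddMonoidHom.coe_mk, ZeroHom.coe_mk, AddSubgroup.coe_subtype] at this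
    simp only [coboundary, realCocycle, AddMonoidHom.coe_mk, ZeroHom.coe_mk,
      AddSubgroup.coe_subtype, ← this]
    push_cast
    rfl)

theorem coboundary_mem_boundedCocycles {φ : G → ℝ} (hφ : IsQuasimorphism φ) :
    coboundary G ℝ φ ∈ boundedCocycles G ℝ := by
  obtain ⟨D, hD⟩ := hφ
  refine ⟨⟨D, fun g h => ?_⟩, fun g h k => ?_⟩
  · rw [Real.norm_eq_abs]
    convert hD g h using 2
    simp only [coboundary, AddMonoidHom.coe_mk, ZeroHom.coe_mk]
    ring
  · simp only [coboundary, AddMonoidHom.coe_mk, ZeroHom.coe_mk, mul_assoc]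
    ring

/-- The class `[δ¹ φ] ∈ H²_b(G, ℝ)` of a quasimorphism `φ`. -/
def quasimorphismClass (φ : G → ℝ) (hφ : IsQuasimorphism φ) : H2b G ℝ :=
  H2b.mk (coboundary G ℝ φ) (coboundary_mem_boundedCocycles hφ)

end BoundedCohomology

/-! ### Orientation preserving homeomorphisms of the circle and the bounded Euler class -/

section Circle

/-- The group `Homeo⁺_ℤ(ℝ)` of orientation preserving homeomorphisms of the line that commute
with the integer translations. -/
def HomeoZ : Subgroup (ℝ ≃ₜ ℝ) where
  carrier := {F | StrictMono F ∧ ∀ (x : ℝ) (n : ℤ), F (x + n) = F x + n}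
  one_mem' := ⟨strictMono_id, fun _ _ => rfl⟩
  mul_mem' := by
    rintro F F' ⟨hF, hF'⟩ ⟨hG, hG'⟩
    refine ⟨hF.comp hG, fun x n => ?_⟩
    change F (F' (x + n)) = F (F' x) + n
    rw [hG', hF']
  inv_mem' := by
    rintro F ⟨hF, hF'⟩
    refine ⟨fun x y hxy => ?_, fun x n => ?_⟩
    · change F.symm x < F.symm y
      rw [← hF.lt_iff_lt]
      simpa using hxy
    · change F.symm (x + n) = F.symm x + n
      apply F.injective
      simp [hF']

/-- `F` is a lift of the circle homeomorphism `f` under `ℝ → ℝ / ℤ`. -/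
def IsLift (F : ℝ ≃ₜ ℝ) (f : UnitAddCircle ≃ₜ UnitAddCircle) : Prop :=
  ∀ x : ℝ, f (x : UnitAddCircle) = ((F x : ℝ) : UnitAddCircle)

/-- The group `Homeo⁺(S¹)` of orientation preserving homeomorphisms of the circle `ℝ / ℤ`,
i.e. of those homeomorphisms that lift to an element of `Homeo⁺_ℤ(ℝ)`. -/
def HomeoCircle : Subgroup (UnitAddCircle ≃ₜ UnitAddCircle) where
  carrier := {f | ∃ F ∈ HomeoZ, IsLift F f}
  one_mem' := ⟨1, one_mem _, fun _ => rfl⟩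
  mul_mem' := by
    rintro f f' ⟨F, hF, hf⟩ ⟨F', hF', hf'⟩
    refine ⟨F * F', mul_mem hF hF', fun x => ?_⟩
    change f (f' x) = ((F (F' x) : ℝ) : UnitAddCircle)
    rw [hf', hf]
  inv_mem' := by
    rintro f ⟨F, hF, hf⟩
    refine ⟨F⁻¹, inv_mem hF, fun x => ?_⟩
    change f.symm x = ((F.symm x : ℝ) : UnitAddCircle)
    rw [f.symm_apply_eq, hf, F.apply_symm_apply]

/-- Two lifts of the same homeomorphism differ by an integer translation. -/
theorem lift_unique {F F' : ℝ ≃ₜ ℝ} {f : UnitAddCircle ≃ₜ UnitAddCircle}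
    (h : IsLift F f) (h' : IsLift F' f) : ∃ n : ℤ, ∀ x, F x = F' x + n := by
  have key : ∀ x, ∃ n : ℤ, (n : ℝ) = F x - F' x := fun x => by
    have : ((F x - F' x : ℝ) : UnitAddCircle) = 0 := by
      rw [AddCircle.coe_sub, ← h, ← h', sub_self]
    obtain ⟨n, hn⟩ := (AddCircle.coe_eq_zero_iff (1 : ℝ)).1 this
    exact ⟨n, by simpa using hn⟩
  choose d hd using key
  have hcont : Continuous d := by
    rw [Int.isClosedEmbedding_coe_real.isEmbedding.continuous_iff]
    have : ((fun n : ℤ => (n : ℝ)) ∘ d) = fun x => F x - F' x := funext hd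
    rw [this]
    exact F.continuous.sub F'.continuous
  refine ⟨d 0, fun x => ?_⟩
  rw [PreconnectedSpace.constant inferInstance hcont (x := 0) (y := x), hd]
  ring

theorem existsUnique_boundedLift (f : HomeoCircle) :
    ∃! F : ℝ ≃ₜ ℝ, F ∈ HomeoZ ∧ IsLift F f ∧ F 0 ∈ Set.Ico (0 : ℝ) 1 := by
  obtain ⟨F, hF, hf⟩ := f.2
  refine ⟨F.trans (Homeomorph.addRight (-(⌊F 0⌋ : ℝ))), ⟨⟨?_, ?_⟩, ?_, ?_⟩, ?_⟩
  · intro x y hxy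
    simpa using hF.1 hxy
  · intro x n
    have := hF.2 x n
    simp only [Homeomorph.trans_apply, Homeomorph.coe_addRight, this]
    ring
  · intro x
    rw [hf x, eq_comm, ← sub_eq_zero, ← AddCircle.coe_sub, AddCircle.coe_eq_zero_iff]
    exact ⟨-⌊F 0⌋, by simp⟩
  · have h1 := Int.floor_le (F 0)
    have h2 := Int.lt_floor_add_one (F 0)
    simp only [Homeomorph.trans_apply, Homeomorph.coe_addRight, Set.mem_Ico]
    constructor <;> linarith
  · rintro F' ⟨-, hf', h0⟩
    obtain ⟨n, hn⟩ := lift_unique hf' hf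
    have hn0 := hn 0
    have : ⌊F 0⌋ = -n := by
      rw [Int.floor_eq_iff]
      push_cast
      constructor <;> linarith [h0.1, h0.2]
    ext x
    simp [this, hn x]

/-- The section `σ_b : Homeo⁺(S¹) → Homeo⁺_ℤ(ℝ)`: the unique lift with `σ_b(f)(0) ∈ [0, 1)`. -/
noncomputable def boundedLift (f : HomeoCircle) : ℝ ≃ₜ ℝ :=
  (existsUnique_boundedLift f).choose

theorem boundedLift_spec (f : HomeoCircle) :
    boundedLift f ∈ HomeoZ ∧ IsLift (boundedLift f) f ∧ boundedLift f 0 ∈ Set.Ico (0 : ℝ) 1 :=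
  (existsUnique_boundedLift f).choose_spec.1

theorem exists_eulerCocycle (f g : HomeoCircle) :
    ∃ n : ℤ, ∀ x, boundedLift f (boundedLift g x) = boundedLift (f * g) x + n := by
  refine lift_unique (F := boundedLift f * boundedLift g) (F' := boundedLift (f * g))
    (f := ((f * g : HomeoCircle) : UnitAddCircle ≃ₜ UnitAddCircle)) ?_ (boundedLift_spec _).2.1
  intro x
  change f.1 (g.1 x) = ((boundedLift f (boundedLift g x) : ℝ) : UnitAddCircle)
  rw [(boundedLift_spec g).2.1, (boundedLift_spec f).2.1]

/-- The cocycle `ω_b(f, g) = σ_b(f) σ_b(g) σ_b(fg)⁻¹`, where the integer `n` is identified with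
the translation `x ↦ x + n`. -/
noncomputable def eulerCocycle (f g : HomeoCircle) : ℤ :=
  (exists_eulerCocycle f g).choose

theorem eulerCocycle_spec (f g : HomeoCircle) (x : ℝ) :
    boundedLift f (boundedLift g x) = boundedLift (f * g) x + eulerCocycle f g :=
  (exists_eulerCocycle f g).choose_spec x

theorem eulerCocycle_eq_zero_or_one (f g : HomeoCircle) :
    eulerCocycle f g = 0 ∨ eulerCocycle f g = 1 := by
  have h := eulerCocycle_spec f g 0
  obtain ⟨⟨hm, ht⟩, -, hf0, hf1⟩ := boundedLift_spec f
  obtain ⟨-, -, hg0, hg1⟩ := boundedLift_spec g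
  obtain ⟨-, -, hfg0, hfg1⟩ := boundedLift_spec (f * g)
  have h1 : boundedLift f 0 ≤ boundedLift f (boundedLift g 0) := hm.monotone hg0
  have h2 : boundedLift f (boundedLift g 0) < boundedLift f 1 := hm hg1
  have h3 := ht 0 1
  simp only [Int.cast_one, zero_add] at h3
  have h4 : (-1 : ℝ) < eulerCocycle f g := by linarith
  have h5 : (eulerCocycle f g : ℝ) < 2 := by linarith
  have h4' : -1 < eulerCocycle f g := by exact_mod_cast h4
  have h5' : eulerCocycle f g < 2 := by exact_mod_cast h5
  omega

theorem eulerCocycle_mem : eulerCocycle ∈ boundedCocycles HomeoCircle ℤ := by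
  refine ⟨⟨1, fun f g => ?_⟩, fun f g h => ?_⟩
  · rcases eulerCocycle_eq_zero_or_one f g with h | h <;> simp [h]
  · have e1 := eulerCocycle_spec f g (boundedLift h 0)
    rw [eulerCocycle_spec (f * g) h, eulerCocycle_spec g h, (boundedLift_spec f).1.2,
      eulerCocycle_spec f (g * h), mul_assoc] at e1
    have e2 : ((eulerCocycle g h - eulerCocycle (f * g) h + eulerCocycle f (g * h)
        - eulerCocycle f g : ℤ) : ℝ) = 0 := by
      push_cast
      linarith
    exact_mod_cast e2

/-- The bounded Euler class `eu_b ∈ H²_b(Homeo⁺(S¹), ℤ)`. -/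
noncomputable def boundedEulerClass : H2b HomeoCircle ℤ :=
  H2b.mk eulerCocycle eulerCocycle_mem

/-- The real bounded Euler class, the image of `eu_b` in `H²_b(Homeo⁺(S¹), ℝ)`. -/
noncomputable def realBoundedEulerClass : H2b HomeoCircle ℝ :=
  H2b.changeOfCoefficients boundedEulerClass

end Circle

end AmalgamScl

open AmalgamScl

/-! The quasimorphism comes from an integer height `f` on the amalgam G whose right translates x ↦ f
(x u), taken up to multiples of a period n, are pairwise comparable pointwise. They form a totally
ordered set on which G acts, commuting with the shift by n. So `f / n` behaves like the displacement
of a point under homeomorphisms of the line commuting with integer translations, and its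
homogenization, a rotation number, has defect at most one
(`HasComparableTranslates.exists_rotation`).

The height is built from relative convexity. The order on cosets gives each element of A or B a sign
in {-1, 0, 1}. Along each coset A x the height is either constant and odd, or equals an even centre
i plus `ε i` times a sign; for B the parities are exchanged. Two such functions never cross: along
an alternating word a strict inequality can only degenerate to an equality at a centre for the next
factor, and from then on both functions move together (`Admissible.le_of_lt`). Such functions exist
for every `ε`, because A and B can be made to act on one set so that the actions agree on C
(`exists_admissible`). An element not conjugate into A or B is conjugate to a cyclically alternating
word; taking `ε` periodic, with the signs of its letters, each letter raises the height by one,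
while the height stays bounded on A and B.

The bound on scl is the easy half of Bavard duality (`IsHomogeneousQuasimorphism.le_scl`). For
countable G, the ordered set of translates is thickened to a dense order, identified with ℚ, and its
automorphisms are extended to ℝ; the induced circle action has the required Euler class. -/

namespace AmalgamScl

/-! ### Height functions on amalgams -/

/-- A left invariant comparison of the cosets `aH` with the base coset `H`. -/
structure IsCosetSign {K : Type*} [Group K] (H : Subgroup K) (s : K → ℤ) : Prop where
  values : ∀ a, s a = -1 ∨ s a = 0 ∨ s a = 1
  eq_zero_iff : ∀ a, s a = 0 ↔ a ∈ H
  mul_right : ∀ a, ∀ c ∈ H, s (a * c) = s a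
  mul_left : ∀ a, ∀ c ∈ H, s (c * a) = s a
  mono : ∀ a a' b, s a < s a' → s (b * a) ≤ s (b * a')

theorem LeftRelativelyConvex.exists_isCosetSign {K : Type*} [Group K] {H : Subgroup K}
    (h : LeftRelativelyConvex H) : ∃ s : K → ℤ, IsCosetSign H s := by
  classical
  obtain ⟨o, ho⟩ := h
  have hlt : ∀ (g : K) (x y : K ⧸ H), x < y → g • x < g • y := fun g x y hxy =>
    lt_of_le_of_ne (ho g x y hxy.le) fun e => hxy.ne (smul_left_cancel g e)
  let s : K → ℤ := fun a => if (a : K ⧸ H) < ((1 : K) : K ⧸ H) then -1 else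
    if ((1 : K) : K ⧸ H) < a then 1 else 0
  have s1 : ∀ a : K, (a : K ⧸ H) < ((1 : K) : K ⧸ H) → s a = -1 := fun a h => if_pos h
  have s2 : ∀ a : K, ((1 : K) : K ⧸ H) < a → s a = 1 := fun a h => by
    simp only [s]; rw [if_neg h.not_gt, if_pos h]
  have s3 : ∀ a : K, ((1 : K) : K ⧸ H) = a → s a = 0 := fun a h => by simp [s, h]
  have base : ∀ c ∈ H, ((1 : K) : K ⧸ H) = (c : K ⧸ H) := fun c hc => by
    rw [QuotientGroup.eq]; simpa using hc
  have right : ∀ a, ∀ c ∈ H, ((a * c : K) : K ⧸ H) = (a : K ⧸ H) := fun a c hc => by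
    rw [eq_comm, QuotientGroup.eq]; simpa using hc
  refine ⟨s, fun a => ?_, fun a => ⟨fun h => ?_, fun h => s3 a (base a h)⟩, fun a c hc => ?_,
    fun a c hc => ?_, fun a a' b h => ?_⟩
  · rcases lt_trichotomy ((1 : K) : K ⧸ H) a with h | h | h
    · simp [s2 a h]
    · simp [s3 a h]
    · simp [s1 a h]
  · rcases lt_trichotomy ((1 : K) : K ⧸ H) a with h' | h' | h'
    · simp [s2 a h'] at h
    · rw [QuotientGroup.eq] at h'; simpa using h'
    · simp [s1 a h'] at h
  · simp only [s, right a c hc]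
  -- Elements of `H` fix the base coset, so translating by them preserves the comparison with it.
  · have e1 : c • ((1 : K) : K ⧸ H) = ((1 : K) : K ⧸ H) := by
      rw [base c hc, MulAction.Quotient.smul_coe, smul_eq_mul, right c c hc]
    have e2 : c • (a : K ⧸ H) = ((c * a : K) : K ⧸ H) := rfl
    rcases lt_trichotomy ((1 : K) : K ⧸ H) a with h | h | h
    · rw [s2 a h, s2]; rw [← e1, ← e2]; exact hlt _ _ _ h
    · rw [s3 a h, s3]; rw [← e1, ← e2, ← h]
    · rw [s1 a h, s1]; rw [← e1, ← e2]; exact hlt _ _ _ h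
  · have smono : ∀ x y : K, (x : K ⧸ H) ≤ (y : K ⧸ H) → s x ≤ s y := by
      intro x y hxy
      rcases lt_trichotomy ((1 : K) : K ⧸ H) x with h1 | h1 | h1
      · rw [s2 x h1, s2 y (h1.trans_le hxy)]
      · rcases hxy.lt_or_eq with h2 | h2
        · rw [s3 x h1, s2 y (by rw [h1]; exact h2)]; norm_num
        · rw [s3 x h1, s3 y (by rw [h1]; exact h2)]
      · rw [s1 x h1]
        rcases lt_trichotomy ((1 : K) : K ⧸ H) y with h2 | h2 | h2
        · rw [s2 y h2]; norm_num
        · rw [s3 y h2]; norm_num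
        · rw [s1 y h2]
    refine smono _ _ (ho b (a : K ⧸ H) (a' : K ⧸ H) ?_)
    by_contra hle
    exact absurd (smono _ _ (le_of_not_ge hle)) (not_le.2 h)

/-- The possible height functions along an orbit of a vertex group `K`: constant with value of the
parity opposite to `p`, or oscillating by at most one around a value of the parity of `p`. -/
def LocalShape {K : Type*} [Group K] (s : K → ℤ) (ε : ℤ → ℤ) (p : ℤ) (F : K → ℤ) : Prop :=
  (∃ i : ℤ, (i - p) % 2 = 1 ∧ ∀ a, F a = i) ∨
    ∃ (i : ℤ) (a₀ : K), (i - p) % 2 = 0 ∧ ∀ a, F a = i + ε i * s (a * a₀)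

/-! ### Comparison of height functions along one vertex group orbit -/

section LocalShape

variable {K : Type*} [Group K] {H : Subgroup K} {s : K → ℤ} {ε : ℤ → ℤ} {p : ℤ} {F F' : K → ℤ}

/-- The parity in the equality case is what matters: it makes the common value a centre for the
other vertex group. -/
theorem LocalShape.lt_or_eq (hs : IsCosetSign H s) (hε : ∀ i, ε i = 1 ∨ ε i = -1)
    (hF : LocalShape s ε p F) (hF' : LocalShape s ε p F') (hlt : F 1 < F' 1) (a : K) :
    F a < F' a ∨ (F a = F' a ∧ (F a - p) % 2 = 1) := by
  rcases hF with ⟨i, hi, h⟩ | ⟨i, b, hi, h⟩ <;> rcases hF' with ⟨j, hj, h'⟩ | ⟨j, b', hj, h'⟩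
  · rw [h, h'] at hlt ⊢; exact Or.inl hlt
  · rw [h, h'] at hlt ⊢
    rcases hε j with e | e <;> rw [e] at hlt ⊢ <;> rcases hs.values (1 * b') with v | v | v <;>
    rcases hs.values (a * b') with v' | v' | v' <;> omega
  · rw [h, h'] at hlt ⊢
    rcases hε i with e | e <;> rw [e] at hlt ⊢ <;> rcases hs.values (1 * b) with v | v | v <;>
    rcases hs.values (a * b) with v' | v' | v' <;> omega
  · rw [h, h'] at hlt ⊢
    by_cases hij : i = j
    · subst hij
      simp only [one_mul] at hlt
      -- With a common centre, monotonicity of the sign preserves the weak inequality. Equality at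
      -- the centre itself would have the wrong parity; it would put `b` and `b'` in the same coset
      -- of `H`, where their signs agree.
      have key : s b ≠ s b' → ¬ (s (a * b) = 0 ∧ s (a * b') = 0) := by
        rintro hne ⟨h1, h2⟩
        rw [hs.eq_zero_iff] at h1 h2
        have : b⁻¹ * b' ∈ H := by simpa [mul_assoc] using H.mul_mem (H.inv_mem h1) h2
        apply hne
        rw [← hs.mul_right b _ this, mul_inv_cancel_left]
      rcases hε i with e | e <;> rw [e] at hlt ⊢
      · have h1 := hs.mono b b' a (by omega)
        have h2 := key (by omega)
        rcases hs.values (a * b) with v | v | v <;>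
        rcases hs.values (a * b') with v' | v' | v' <;> omega
      · have h1 := hs.mono b' b a (by omega)
        have h2 := key (by omega)
        rcases hs.values (a * b) with v | v | v <;>
        rcases hs.values (a * b') with v' | v' | v' <;> omega
    -- Distinct centres of the same parity are at least two apart and oscillations are at most one,
    -- so the values can meet only midway, at the other parity.
    · have e1 : ∀ x, ε i * s x = -1 ∨ ε i * s x = 0 ∨ ε i * s x = 1 := fun x => by
        rcases hε i with e | e <;> rw [e] <;> rcases hs.values x with v | v | v <;> omega
      have e2 : ∀ x, ε j * s x = -1 ∨ ε j * s x = 0 ∨ ε j * s x = 1 := fun x => by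
        rcases hε j with e | e <;> rw [e] <;> rcases hs.values x with v | v | v <;> omega
      have := e1 (1 * b)
      have := e1 (a * b)
      have := e2 (1 * b')
      have := e2 (a * b')
      omega

/-- A value of parity `p` at `1` must be the centre, so `a₀` lies in `H` and drops out: the value at
`1` determines the whole function. -/
theorem LocalShape.apply_eq (hs : IsCosetSign H s) (hε : ∀ i, ε i = 1 ∨ ε i = -1)
    (hF : LocalShape s ε p F) (h1 : (F 1 - p) % 2 = 0) (a : K) : F a = F 1 + ε (F 1) * s a := by
  rcases hF with ⟨i, hi, h⟩ | ⟨i, b, hi, h⟩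
  · rw [h] at h1; omega
  · have hb : s b = 0 := by
      have := h 1
      rw [one_mul] at this
      rcases hε i with e | e <;> rw [e] at this <;> rcases hs.values b with v | v | v <;> omega
    have e1 : F 1 = i := by rw [h, one_mul, hb]; simp
    rw [e1, h, hs.mul_right _ _ ((hs.eq_zero_iff b).1 hb)]

theorem LocalShape.add_const {n : ℤ} (hF : LocalShape s ε p F) (hn : n % 2 = 0)
    (hper : ∀ i, ε (i + n) = ε i) : LocalShape s ε p (fun a => F a + n) := by
  rcases hF with ⟨i, hi, h⟩ | ⟨i, b, hi, h⟩
  · exact Or.inl ⟨i + n, by omega, fun a => by simp [h]⟩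
  · exact Or.inr ⟨i + n, b, by omega, fun a => by simp only [h, hper]; ring⟩

theorem LocalShape.exists_bound (hs : IsCosetSign H s) (hε : ∀ i, ε i = 1 ∨ ε i = -1)
    (hF : LocalShape s ε p F) : ∃ M : ℤ, ∀ a, |F a| ≤ M := by
  rcases hF with ⟨i, hi, h⟩ | ⟨i, b, hi, h⟩
  · exact ⟨|i|, fun a => by rw [h]⟩
  · refine ⟨|i| + 1, fun a => ?_⟩
    rw [h]
    refine (abs_add_le _ _).trans (add_le_add le_rfl ?_)
    rcases hε i with e | e <;> rw [e] <;> rcases hs.values (a * b) with v | v | v <;> simp [v]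

end LocalShape

/-! ### Actions of a vertex group with prescribed heights -/

/-- A type over `ℤ` all of whose fibres have the cardinality of `Ω` is a product. -/
theorem exists_equiv_prod_int {Z Ω : Type*} (k : Z → ℤ) (i : Z → Ω) (hi : Function.Injective i)
    (j : ℤ → Ω → Z) (hj : ∀ m, Function.Injective (j m)) (hk : ∀ m ω, k (j m ω) = m) :
    ∃ e : Z ≃ Ω × ℤ, ∀ z, (e z).2 = k z := by
  have : ∀ m : ℤ, Nonempty ({z // k z = m} ≃ Ω) := fun m =>
    Function.Embedding.antisymm ⟨fun z => i z.1, fun z z' h => Subtype.ext (hi h)⟩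
      ⟨fun ω => ⟨j m ω, hk m ω⟩, fun ω ω' h => hj m (congrArg Subtype.val h)⟩
  have e := fun m => (this m).some
  refine ⟨⟨fun z => (e (k z) ⟨z, rfl⟩, k z), fun q => ((e q.2).symm q.1).1, fun z => by simp, ?_⟩,
    fun z => rfl⟩
  rintro ⟨ω, m⟩
  have h := ((e m).symm ω).2
  refine Prod.ext ?_ h
  have gen : ∀ (z : Z) (m : ℤ) (hz : k z = m), e (k z) ⟨z, rfl⟩ = e m ⟨z, hz⟩ := by
    rintro z m rfl; rfl
  change e (k _) ⟨_, rfl⟩ = ω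
  rw [gen _ m h]
  simp

/-- An action of a vertex group `K` on `C × Ω × ℤ` that extends the translation action of `C` and
along whose orbits the last coordinate has the local shape. -/
theorem exists_action_localShape {K C Ω : Type*} [Group K] [Group C] (κ : C →* K)
    (hκ : Function.Injective κ) {s : K → ℤ} (hs : IsCosetSign κ.range s) (ε : ℤ → ℤ) (p : ℤ)
    (i : K × Ω × ℤ → Ω) (hi : Function.Injective i) :
    ∃ σ : K →* Equiv.Perm (C × Ω × ℤ), (∀ c y, σ (κ c) y = (c * y.1, y.2)) ∧
      ∀ y, LocalShape s ε p (fun a => (σ a y).2.2) := by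
  classical
  let τ := MonoidHom.ofInjective hκ
  have hτ : ∀ c, ((τ c : κ.range) : K) = κ c := fun c => MonoidHom.ofInjective_apply hκ
  have hτ' : ∀ x : κ.range, κ (τ.symm x) = x := fun x => by rw [← hτ, MulEquiv.apply_symm_apply]
  have hmem : ∀ a : K, a * ((a⁻¹ : K) : K ⧸ κ.range).out ∈ κ.range := fun a => by
    have := QuotientGroup.out_eq' ((a⁻¹ : K) : K ⧸ κ.range)
    rw [eq_comm, QuotientGroup.eq] at this
    simpa using this
  have hout : ∀ (x : κ.range) (q : K ⧸ κ.range),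
      ((((x : K) * q.out⁻¹)⁻¹ : K) : K ⧸ κ.range) = q := fun x q => by
    conv_rhs => rw [← QuotientGroup.out_eq' q]
    rw [eq_comm, QuotientGroup.eq]
    simp
  -- Decomposition into right cosets of the image of C; inversion turns them into the left cosets
  -- indexing `K ⧸ κ.range`.
  let E : K ≃ C × (K ⧸ κ.range) :=
    { toFun := fun a => (τ.symm ⟨_, hmem a⟩, ((a⁻¹ : K) : K ⧸ κ.range))
      invFun := fun q => κ q.1 * q.2.out⁻¹
      left_inv := fun a => by simp [hτ']
      right_inv := fun q => by
        obtain ⟨c, q⟩ := q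
        have h := hout (τ c) q
        rw [hτ] at h
        refine Prod.ext ?_ h
        simp only
        rw [MulEquiv.symm_apply_eq]
        ext
        simp only [h, hτ]
        group }
  have hE : ∀ c q, E.symm (c, q) = κ c * q.out⁻¹ := fun c q => rfl
  -- The sign is invariant under left multiplication by C, so the height descends to right cosets.
  let k : (K ⧸ κ.range) × Ω × ℤ → ℤ := fun z =>
    if (z.2.2 - p) % 2 = 0 then z.2.2 + ε z.2.2 * s z.1.out⁻¹ else z.2.2
  have hone : s ((1 : K) : K ⧸ κ.range).out⁻¹ = 0 := by
    rw [hs.eq_zero_iff, inv_mem_iff]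
    simpa using hmem 1
  -- Each fibre of `k` injects into `Ω` through `i`, and contains a copy of `Ω` over the trivial
  -- coset, where the sign vanishes and the height is `m`.
  obtain ⟨e, he⟩ := exists_equiv_prod_int k (fun z => i (z.1.out, z.2))
    (fun z z' h => by
      have := hi h
      rw [Prod.mk.injEq] at this
      exact Prod.ext (Quotient.out_injective this.1) this.2)
    (fun m ω => (((1 : K) : K ⧸ κ.range), ω, m)) (fun m ω ω' h => by simpa using h)
    (fun m ω => by simp only [k, hone]; simp)
  let Φ : K × Ω × ℤ ≃ C × Ω × ℤ := (E.prodCongr (Equiv.refl _)).trans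
    ((Equiv.prodAssoc _ _ _).trans ((Equiv.refl C).prodCongr e))
  have hΦ : ∀ c q z, Φ (κ c * q.out⁻¹, z) = (c, e (q, z)) := fun c q z => by
    have : E (κ c * q.out⁻¹) = (c, q) := by rw [← hE, Equiv.apply_symm_apply]
    simp [Φ, this]
  have hdec : ∀ a : K, ∃ (c : C) (q : K ⧸ κ.range), a = κ c * q.out⁻¹ := fun a =>
    ⟨(E a).1, (E a).2, by rw [← hE, Prod.mk.eta, Equiv.symm_apply_apply]⟩
  have hheight : ∀ a (z : Ω × ℤ), (Φ (a, z)).2.2 =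
      if (z.2 - p) % 2 = 0 then z.2 + ε z.2 * s a else z.2 := fun a z => by
    obtain ⟨c, q, rfl⟩ := hdec a
    rw [hΦ, he, hs.mul_left _ _ ⟨c, rfl⟩]
  -- Left multiplication on `K × Ω × ℤ`, transported along `Φ`.
  let σ : K →* Equiv.Perm (C × Ω × ℤ) :=
    { toFun := fun a => Φ.symm.trans (((Equiv.mulLeft a).prodCongr (Equiv.refl _)).trans Φ)
      map_one' := by ext1 y; simp
      map_mul' := fun a b => by ext1 y; simp [Prod.map] }
  have hσ : ∀ a b z, σ a (Φ (b, z)) = Φ (a * b, z) := fun a b z => by simp [σ]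
  refine ⟨σ, fun c y => ?_, fun y => ?_⟩ <;> obtain ⟨⟨b, z⟩, rfl⟩ := Φ.surjective y
  · obtain ⟨d, q, rfl⟩ := hdec b
    rw [hσ, ← mul_assoc, ← map_mul, hΦ, hΦ]
  · by_cases hz : (z.2 - p) % 2 = 0
    · exact Or.inr ⟨z.2, b, hz, fun a => by simp only [hσ]; rw [hheight, if_pos hz]⟩
    · exact Or.inl ⟨z.2, by omega, fun a => by simp only [hσ]; rw [hheight, if_neg hz]⟩

/-! ### Alternating words and admissible height functions -/

section Words

variable {A B C : Type*} [Group A] [Group B] [Group C] {κA : C →* A} {κB : C →* B}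
  {sA : A → ℤ} {sB : B → ℤ}

theorem Amalgam.inl_eq_inr (κA : C →* A) (κB : C →* B) (c : C) :
    Amalgam.inl κA κB (κA c) = Amalgam.inr κA κB (κB c) := by
  refine QuotientGroup.eq.2 (Subgroup.subset_normalClosure ⟨c, rfl⟩)

/-- The element of the amalgam represented by a letter. -/
def letterVal (κA : C →* A) (κB : C →* B) : A ⊕ B → Amalgam κA κB :=
  Sum.elim (Amalgam.inl κA κB) (Amalgam.inr κA κB)

/-- The parity of the heights around which the vertex group of a letter oscillates. -/
def letterParity {A B : Type*} : A ⊕ B → ℤ := Sum.elim (fun _ => 0) (fun _ => 1)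

theorem letterParity_eq {A B : Type*} (x : A ⊕ B) : letterParity x = 0 ∨ letterParity x = 1 := by
  cases x <;> simp [letterParity]

/-- Two letters of different vertex groups, neither of which is in the edge group. -/
def Alternating (sA : A → ℤ) (sB : B → ℤ) (x y : A ⊕ B) : Prop :=
  letterParity x ≠ letterParity y ∧ Sum.elim sA sB x ≠ 0 ∧ Sum.elim sA sB y ≠ 0

/-- Letters of one factor multiply there; a letter of sign zero comes from C and can be moved to the
other factor. -/
theorem exists_letterVal_eq_mul (hA : IsCosetSign κA.range sA) (hB : IsCosetSign κB.range sB)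
    {x y : A ⊕ B} (h : ¬ Alternating sA sB x y) :
    ∃ z, letterVal κA κB z = letterVal κA κB x * letterVal κA κB y := by
  have hA' : ∀ a, sA a = 0 → ∃ c, κA c = a := fun a h => (hA.eq_zero_iff a).1 h
  have hB' : ∀ a, sB a = 0 → ∃ c, κB c = a := fun a h => (hB.eq_zero_iff a).1 h
  rcases x with a | b <;> rcases y with a' | b'
  · exact ⟨Sum.inl (a * a'), map_mul _ _ _⟩
  · by_cases h1 : sA a = 0
    · obtain ⟨c, rfl⟩ := hA' a h1
      refine ⟨Sum.inr (κB c * b'), ?_⟩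
      simp [letterVal, Amalgam.inl_eq_inr]
    · by_cases h2 : sB b' = 0
      · obtain ⟨c, rfl⟩ := hB' b' h2
        refine ⟨Sum.inl (a * κA c), ?_⟩
        simp [letterVal, Amalgam.inl_eq_inr]
      · exact absurd ⟨by simp [letterParity], h1, h2⟩ h
  · by_cases h1 : sB b = 0
    · obtain ⟨c, rfl⟩ := hB' b h1
      refine ⟨Sum.inl (κA c * a'), ?_⟩
      simp [letterVal, Amalgam.inl_eq_inr]
    · by_cases h2 : sA a' = 0
      · obtain ⟨c, rfl⟩ := hA' a' h2
        refine ⟨Sum.inr (b * κB c), ?_⟩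
        simp [letterVal, Amalgam.inl_eq_inr]
      · exact absurd ⟨by simp [letterParity], h1, h2⟩ h
  · exact ⟨Sum.inr (b * b'), map_mul _ _ _⟩

/-- The element of the amalgam represented by a word. -/
def wordVal (κA : C →* A) (κB : C →* B) (l : List (A ⊕ B)) : Amalgam κA κB :=
  (l.map (letterVal κA κB)).prod

@[simp] theorem wordVal_nil : wordVal κA κB [] = 1 := rfl

@[simp] theorem wordVal_cons (x : A ⊕ B) (l : List (A ⊕ B)) :
    wordVal κA κB (x :: l) = letterVal κA κB x * wordVal κA κB l := by simp [wordVal]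

@[simp] theorem wordVal_append (l m : List (A ⊕ B)) :
    wordVal κA κB (l ++ m) = wordVal κA κB l * wordVal κA κB m := by simp [wordVal]

theorem exists_wordVal_eq (g : Amalgam κA κB) : ∃ l, wordVal κA κB l = g := by
  obtain ⟨x, rfl⟩ := QuotientGroup.mk'_surjective _ g
  induction x using Monoid.Coprod.induction_on with
  | inl a => exact ⟨[Sum.inl a], by simp [letterVal, Amalgam.inl]⟩
  | inr b => exact ⟨[Sum.inr b], by simp [letterVal, Amalgam.inr]⟩
  | mul x y hx hy =>
    obtain ⟨l, hl⟩ := hx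
    obtain ⟨m, hm⟩ := hy
    exact ⟨l ++ m, by rw [wordVal_append, hl, hm, map_mul]⟩

theorem exists_shorter_word (hA : IsCosetSign κA.range sA) (hB : IsCosetSign κB.range sB)
    (l : List (A ⊕ B)) (hl : ¬ l.IsChain (Alternating sA sB)) :
    ∃ m, wordVal κA κB m = wordVal κA κB l ∧ m.length < l.length := by
  induction l with
  | nil => exact absurd List.IsChain.nil hl
  | cons x l ih =>
    by_cases h : l.IsChain (Alternating sA sB)
    · cases l with
      | nil => exact absurd (List.IsChain.singleton x) hl
      | cons y l =>
        have : ¬ Alternating sA sB x y := fun hxy => hl (List.isChain_cons_cons.2 ⟨hxy, h⟩)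
        obtain ⟨z, hz⟩ := exists_letterVal_eq_mul hA hB this
        exact ⟨z :: l, by simp [hz, mul_assoc], by simp⟩
    · obtain ⟨m, hm, hlt⟩ := ih h
      exact ⟨x :: m, by simp [hm], by simpa using hlt⟩

theorem exists_alternating_word (hA : IsCosetSign κA.range sA) (hB : IsCosetSign κB.range sB)
    (g : Amalgam κA κB) : ∃ l, wordVal κA κB l = g ∧ l.IsChain (Alternating sA sB) := by
  obtain ⟨l, hl, hmin⟩ := WellFounded.has_min (measure (List.length (α := A ⊕ B))).wf
    {l | wordVal κA κB l = g} (exists_wordVal_eq g)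
  refine ⟨l, hl, ?_⟩
  by_contra h
  obtain ⟨m, hm, hlt⟩ := exists_shorter_word hA hB l h
  exact hmin m (hm.trans hl) hlt

/-- An element that is not conjugate into a vertex group is conjugate to a cyclically alternating
word. -/
theorem exists_cyclically_alternating (hA : IsCosetSign κA.range sA)
    (hB : IsCosetSign κB.range sB) (g : Amalgam κA κB)
    (hgA : ∀ (x : Amalgam κA κB) (a : A), x * g * x⁻¹ ≠ Amalgam.inl κA κB a)
    (hgB : ∀ (x : Amalgam κA κB) (b : B), x * g * x⁻¹ ≠ Amalgam.inr κA κB b) :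
    ∃ (x : Amalgam κA κB) (s t : A ⊕ B) (l : List (A ⊕ B)),
      wordVal κA κB (s :: (l ++ [t])) = x * g * x⁻¹ ∧
      (s :: (l ++ [t])).IsChain (Alternating sA sB) ∧ Alternating sA sB t s := by
  obtain ⟨l, ⟨x, hx⟩, hmin⟩ := WellFounded.has_min (measure (List.length (α := A ⊕ B))).wf
    {l | ∃ x, wordVal κA κB l = x * g * x⁻¹} (by
      obtain ⟨l, hl⟩ := exists_wordVal_eq g
      exact ⟨l, 1, by simpa using hl⟩)
  have hc : l.IsChain (Alternating sA sB) := by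
    by_contra h
    obtain ⟨m, hm, hlt⟩ := exists_shorter_word hA hB l h
    exact hmin m ⟨x, hm.trans hx⟩ hlt
  cases l with
  | nil => exact absurd (by rw [← hx]; simp) (hgA x 1)
  | cons s l =>
    rcases List.eq_nil_or_concat l with rfl | ⟨l, t, rfl⟩
    · rcases s with a | b
      · exact absurd (by rw [← hx]; simp [letterVal]) (hgA x a)
      · exact absurd (by rw [← hx]; simp [letterVal]) (hgB x b)
    · rw [List.concat_eq_append] at hx hc hmin
      refine ⟨x, s, t, l, hx, hc, ?_⟩
      by_contra h
      -- Conjugating by the last letter moves it to the front, where it merges with `s` and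
      -- contradicts minimal length among conjugates.
      obtain ⟨z, hz⟩ := exists_letterVal_eq_mul hA hB h
      refine hmin (z :: l) ⟨letterVal κA κB t * x, ?_⟩ (by
        change (z :: l).length < (s :: (l ++ [t])).length
        simp)
      have : letterVal κA κB t * (x * g * x⁻¹) * (letterVal κA κB t)⁻¹ = wordVal κA κB (z :: l) := by
        rw [← hx]
        simp [hz, mul_assoc]
      rw [← this]
      group

/-- A function on the amalgam whose restrictions to the orbits of the vertex groups have local
shape. -/
def Admissible (sA : A → ℤ) (sB : B → ℤ) (ε : ℤ → ℤ) (f : Amalgam κA κB → ℤ) : Prop :=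
  ∀ x, LocalShape sA ε 0 (fun a => f (Amalgam.inl κA κB a * x)) ∧
    LocalShape sB ε 1 (fun b => f (Amalgam.inr κA κB b * x))

variable {ε : ℤ → ℤ} {f f' : Amalgam κA κB → ℤ}

theorem Admissible.translate (hf : Admissible sA sB ε f) (u : Amalgam κA κB) :
    Admissible sA sB ε (fun x => f (x * u)) := fun x => by
  simpa only [mul_assoc] using hf (x * u)

theorem Admissible.add_const (hf : Admissible sA sB ε f) {n : ℤ} (hn : n % 2 = 0)
    (hper : ∀ i, ε (i + n) = ε i) : Admissible sA sB ε (fun x => f x + n) := fun x =>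
  ⟨(hf x).1.add_const hn hper, (hf x).2.add_const hn hper⟩

theorem Admissible.letter_lt_or_eq (hA : IsCosetSign κA.range sA) (hB : IsCosetSign κB.range sB)
    (hε : ∀ i, ε i = 1 ∨ ε i = -1) (hf : Admissible sA sB ε f) (hf' : Admissible sA sB ε f')
    {x : Amalgam κA κB} (h : f x < f' x) (s : A ⊕ B) :
    f (letterVal κA κB s * x) < f' (letterVal κA κB s * x) ∨
      (f (letterVal κA κB s * x) = f' (letterVal κA κB s * x) ∧
        (f (letterVal κA κB s * x) - letterParity s) % 2 = 1) := by
  rcases s with a | b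
  · exact (hf x).1.lt_or_eq hA hε (hf' x).1 (by simpa using h) a
  · exact (hf x).2.lt_or_eq hB hε (hf' x).2 (by simpa using h) b

theorem Admissible.letter_eq (hA : IsCosetSign κA.range sA) (hB : IsCosetSign κB.range sB)
    (hε : ∀ i, ε i = 1 ∨ ε i = -1) (hf : Admissible sA sB ε f)
    {x : Amalgam κA κB} {s : A ⊕ B} (h : (f x - letterParity s) % 2 = 0) :
    f (letterVal κA κB s * x) = f x + ε (f x) * Sum.elim sA sB s := by
  rcases s with a | b
  · simpa [letterVal] using (hf x).1.apply_eq hA hε (by rw [map_one, one_mul]; exact h) a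
  · simpa [letterVal] using (hf x).2.apply_eq hB hε (by rw [map_one, one_mul]; exact h) b

/-- This non-crossing property is the source of the total order on translates. -/
theorem Admissible.le_of_lt (hA : IsCosetSign κA.range sA) (hB : IsCosetSign κB.range sB)
    (hε : ∀ i, ε i = 1 ∨ ε i = -1) (hf : Admissible sA sB ε f) (hf' : Admissible sA sB ε f')
    {x : Amalgam κA κB} (h : f x < f' x) (g : Amalgam κA κB) : f (g * x) ≤ f' (g * x) := by
  obtain ⟨l, rfl, hl⟩ := exists_alternating_word hA hB g
  -- Letters act from the right end, so the head is the letter applied last. In the equality case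
  -- the value is not of the parity of that letter.
  have key : f (wordVal κA κB l * x) < f' (wordVal κA κB l * x) ∨
      (f (wordVal κA κB l * x) = f' (wordVal κA κB l * x) ∧
        ∃ s ∈ l.head?, (f (wordVal κA κB l * x) - letterParity s) % 2 = 1) := by
    induction l with
    | nil => left; simpa using h
    | cons s l ih =>
      rw [wordVal_cons, mul_assoc]
      rcases ih hl.tail with h1 | ⟨h1, t, ht, h2⟩
      · rcases hf.letter_lt_or_eq hA hB hε hf' h1 s with h3 | ⟨h3, h4⟩
        · exact Or.inl h3
        · exact Or.inr ⟨h3, s, rfl, h4⟩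
      · have hst : Alternating sA sB s t := (List.isChain_cons.1 hl).1 t ht
        -- The next letter belongs to the other factor, so the common value is a centre for it and
        -- both functions change by the same amount. As its sign is nonzero, the parity flips again.
        have hpar : (f (wordVal κA κB l * x) - letterParity s) % 2 = 0 := by
          have := hst.1
          rcases letterParity_eq s with e | e <;> rcases letterParity_eq t with e' | e' <;> omega
        have e1 := hf.letter_eq hA hB hε hpar
        have e2 := hf'.letter_eq hA hB hε (h1 ▸ hpar)
        right
        rw [e1, e2, h1]
        refine ⟨rfl, s, rfl, ?_⟩
        rw [h1] at hpar
        have h0 := hst.2.1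
        have hv : Sum.elim sA sB s = -1 ∨ Sum.elim sA sB s = 0 ∨ Sum.elim sA sB s = 1 := by
          cases s with
          | inl a => exact hA.values a
          | inr b => exact hB.values b
        rcases hε (f' (wordVal κA κB l * x)) with e | e <;> rw [e] <;>
          rcases hv with e' | e' | e' <;> rw [e'] at h0 ⊢ <;> omega
  rcases key with h | h
  exacts [h.le, h.1.le]

/-- Both vertex groups act on the same set `C × Ω × ℤ` and induce the same action of C, so the
amalgam acts. The height is the last coordinate along an orbit. -/
theorem exists_admissible (hκA : Function.Injective κA) (hκB : Function.Injective κB)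
    (hA : IsCosetSign κA.range sA) (hB : IsCosetSign κB.range sB) (ε : ℤ → ℤ) (p : ℤ) :
    ∃ f : Amalgam κA κB → ℤ, Admissible sA sB ε f ∧ f 1 = p := by
  -- Sequences absorb one further entry, which provides the injections of `A × Ω × ℤ` and `B × Ω ×
  -- ℤ` into `Ω`.
  let Ω := ℕ → A × B × ℤ
  let cons : (A × B × ℤ) → Ω → Ω := fun x ω n => Nat.casesOn n x ω
  have hcons : ∀ x x' ω ω', cons x ω = cons x' ω' → x = x' ∧ ω = ω' := fun x x' ω ω' h =>
    ⟨congrFun h 0, funext fun n => congrFun h (n + 1)⟩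
  obtain ⟨σA, hσA, hA'⟩ := exists_action_localShape κA hκA hA ε 0
    (fun z : A × Ω × ℤ => cons (z.1, 1, z.2.2) z.2.1) (by
      rintro ⟨a, ω, m⟩ ⟨a', ω', m'⟩ h
      have := hcons _ _ _ _ h
      simp only [Prod.mk.injEq] at this ⊢
      tauto)
  obtain ⟨σB, hσB, hB'⟩ := exists_action_localShape κB hκB hB ε 1
    (fun z : B × Ω × ℤ => cons (1, z.1, z.2.2) z.2.1) (by
      rintro ⟨a, ω, m⟩ ⟨a', ω', m'⟩ h
      have := hcons _ _ _ _ h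
      simp only [Prod.mk.injEq] at this ⊢
      tauto)
  let σ : Amalgam κA κB →* Equiv.Perm (C × Ω × ℤ) :=
    QuotientGroup.lift (amalgamRel κA κB) (Monoid.Coprod.lift σA σB) (by
      refine (Subgroup.normalClosure_le_normal (N := (Monoid.Coprod.lift σA σB).ker) ?_)
      rintro _ ⟨c, rfl⟩
      have : σA (κA c) = σB (κB c) := Equiv.ext fun y => (hσA c y).trans (hσB c y).symm
      simp [MonoidHom.mem_ker, this])
  have hσl : ∀ a, σ (Amalgam.inl κA κB a) = σA a := fun a => by
    change Monoid.Coprod.lift σA σB (Monoid.Coprod.inl a) = σA a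
    simp
  have hσr : ∀ b, σ (Amalgam.inr κA κB b) = σB b := fun b => by
    change Monoid.Coprod.lift σA σB (Monoid.Coprod.inr b) = σB b
    simp
  refine ⟨fun g => (σ g (1, fun _ => 1, p)).2.2, fun x => ⟨?_, ?_⟩, by simp⟩
  · simpa [hσl] using hA' (σ x (1, fun _ => 1, p))
  · simpa [hσr] using hB' (σ x (1, fun _ => 1, p))

omit [Group A] [Group B] in
theorem Alternating.parity_getLast {s t : A ⊕ B} {m : List (A ⊕ B)}
    (h : (s :: m).IsChain (Alternating sA sB)) (ht : (s :: m).getLast? = some t) :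
    (letterParity t + m.length - letterParity s) % 2 = 0 := by
  induction m generalizing s with
  | nil => simp_all
  | cons x m ih =>
    rw [List.isChain_cons_cons] at h
    have h1 := ih h.2 (by simpa [List.getLast?_cons_cons] using ht)
    have h2 := h.1.1
    rw [List.length_cons]
    rcases letterParity_eq s with e | e <;> rcases letterParity_eq t with e' | e' <;>
      rcases letterParity_eq x with e'' | e'' <;> omega

omit [Group A] [Group B] in
theorem Alternating.sign_ne_zero {s x : A ⊕ B} {m : List (A ⊕ B)}
    (h : (s :: m).IsChain (Alternating sA sB)) (hx : x ∈ m) : Sum.elim sA sB x ≠ 0 := by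
  induction m generalizing s with
  | nil => simp at hx
  | cons y m ih =>
    rw [List.isChain_cons_cons] at h
    rcases List.mem_cons.1 hx with rfl | hx
    exacts [h.1.2.2, ih h.2 hx]

/-- For a suffix `s :: m`, the letter `s` meets the height `f x + m.length`; the hypothesis says
that this is a centre for its factor and that `s` raises it by exactly one. -/
theorem Admissible.wordVal_eq (hA : IsCosetSign κA.range sA) (hB : IsCosetSign κB.range sB)
    (hε : ∀ i, ε i = 1 ∨ ε i = -1) (hf : Admissible sA sB ε f) (x : Amalgam κA κB)
    (l : List (A ⊕ B)) (h : ∀ s m, s :: m <:+ l → (f x + m.length - letterParity s) % 2 = 0 ∧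
      ε (f x + m.length) * Sum.elim sA sB s = 1) :
    f (wordVal κA κB l * x) = f x + l.length := by
  induction l with
  | nil => simp
  | cons s l ih =>
    have h1 := ih fun t m hm => h t m (hm.trans (List.suffix_cons s l))
    obtain ⟨h2, h3⟩ := h s l List.suffix_rfl
    rw [wordVal_cons, mul_assoc, hf.letter_eq hA hB hε (by rwa [h1]), h1, h3]
    push_cast [List.length_cons]
    ring

/-- The main construction: a height function on the amalgam whose translates are totally ordered,
which is bounded on the vertex groups and grows linearly along a conjugate of `g`. -/
theorem exists_height_function (hκA : Function.Injective κA) (hκB : Function.Injective κB)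
    (hA : LeftRelativelyConvex κA.range) (hB : LeftRelativelyConvex κB.range)
    (g : Amalgam κA κB)
    (hgA : ∀ (x : Amalgam κA κB) (a : A), x * g * x⁻¹ ≠ Amalgam.inl κA κB a)
    (hgB : ∀ (x : Amalgam κA κB) (b : B), x * g * x⁻¹ ≠ Amalgam.inr κA κB b) :
    ∃ (f : Amalgam κA κB → ℤ) (n : ℤ), 0 < n ∧
      (∀ u v (m : ℤ), (∀ x, f (x * u) ≤ f (x * v) + m * n) ∨
        ∀ x, f (x * v) + m * n ≤ f (x * u)) ∧
      (∃ M : ℤ, ∀ a, |f (Amalgam.inl κA κB a)| ≤ M) ∧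
      (∃ M : ℤ, ∀ b, |f (Amalgam.inr κA κB b)| ≤ M) ∧
      ∃ x, ∀ k : ℕ, f ((x * g * x⁻¹) ^ k) = f 1 + k * n := by
  obtain ⟨sA, hA⟩ := hA.exists_isCosetSign
  obtain ⟨sB, hB⟩ := hB.exists_isCosetSign
  obtain ⟨x, s, t, l, hw, hc, hts⟩ := exists_cyclically_alternating hA hB g hgA hgB
  set w : List (A ⊕ B) := s :: (l ++ [t]) with hwdef
  have hlast : w.getLast? = some t := by
    rw [hwdef, ← List.cons_append, List.getLast?_append]; simp
  have hc' : (t :: w).IsChain (Alternating sA sB) := by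
    rw [hwdef, List.isChain_cons_cons]; exact ⟨hts, hc⟩
  have hpos : 0 < (w.length : ℤ) := by simp [hwdef]; positivity
  -- Cyclic alternation forces even length, so adding a multiple of the length preserves the
  -- parities of centres.
  have heven : (w.length : ℤ) % 2 = 0 := by
    have := Alternating.parity_getLast hc' (t := t) (by rw [hwdef, List.getLast?_cons_cons]; exact hlast)
    simpa using this
  -- Periodic signs: the height `letterParity t + j` receives the sign of the letter in position `j`
  -- from the right end of `w`, modulo the length.
  let ε : ℤ → ℤ := fun i =>
    Sum.elim sA sB (w.reverse.getD ((i - letterParity t) % w.length).toNat t)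
  have hsign : ∀ y ∈ w, Sum.elim sA sB y = 1 ∨ Sum.elim sA sB y = -1 := fun y hy => by
    have h0 := Alternating.sign_ne_zero hc' hy
    have hv : Sum.elim sA sB y = -1 ∨ Sum.elim sA sB y = 0 ∨ Sum.elim sA sB y = 1 := by
      cases y with
      | inl a => exact hA.values a
      | inr b => exact hB.values b
    tauto
  -- The default `t` is itself a letter of `w`, so this case also has a nonzero sign.
  have hε : ∀ i, ε i = 1 ∨ ε i = -1 := fun i => hsign _ (by
    rw [List.getD_eq_getElem?_getD]
    cases h : w.reverse[((i - letterParity t) % w.length).toNat]? with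
    | none => simp [hwdef]
    | some y => simpa using List.mem_of_getElem? h)
  have hper : ∀ m i : ℤ, ε (i + m * w.length) = ε i := fun m i => by
    simp only [ε]
    rw [show i + m * w.length - letterParity t = i - letterParity t + m * w.length by ring,
      Int.add_mul_emod_self_right]
  have hεs : ∀ y m, y :: m <:+ w → ∀ k : ℤ,
      ε (letterParity t + k * w.length + m.length) = Sum.elim sA sB y := by
    rintro y m ⟨u, hu⟩ k
    have hlen : m.length < w.length := by rw [← hu, List.length_append, List.length_cons]; omega
    have : ((letterParity t + k * w.length + m.length - letterParity t) % w.length).toNat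
        = m.length := by
      rw [show letterParity t + k * w.length + m.length - letterParity t
        = (m.length : ℤ) + k * w.length by ring, Int.add_mul_emod_self_right,
        Int.emod_eq_of_lt (by positivity) (by exact_mod_cast hlen)]
      simp
    simp only [ε, this]
    rw [← hu]
    simp [List.getD_eq_getElem?_getD]
  obtain ⟨f, hf, hf1⟩ := exists_admissible hκA hκB hA hB ε (letterParity t)
  have hstep : ∀ (y : Amalgam κA κB) (k : ℤ), f y = letterParity t + k * w.length →
      f (wordVal κA κB w * y) = f y + w.length := fun y k hy => by
    refine hf.wordVal_eq hA hB hε y w fun r m hm => ⟨?_, ?_⟩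
    · have hcm := hc.suffix hm
      have := Alternating.parity_getLast hcm (t := t) (by
        rw [← hlast]
        obtain ⟨u, hu⟩ := hm
        rw [← hu, List.getLast?_append_of_ne_nil _ (by simp)])
      have hk : (k * w.length) % 2 = 0 := by rw [Int.mul_emod, heven]; simp
      rw [hy]
      omega
    · rw [hy, hεs r m hm]
      rcases hsign r (hm.mem (by simp)) with e | e <;> rw [e] <;> norm_num
  refine ⟨f, w.length, hpos, fun u v m => ?_, ?_, ?_, x, fun k => ?_⟩
  · have hu := hf.translate u
    have hv := (hf.translate v).add_const (n := m * w.length)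
      (by rw [Int.mul_emod, heven]; simp) (hper m)
    -- Incomparability would give strict inequalities in opposite directions at `y` and `z`,
    -- contradicting non-crossing from `y` to `z`.
    by_contra! h
    obtain ⟨⟨y, hy⟩, z, hz⟩ := h
    have := hv.le_of_lt hA hB hε hu hy (z * y⁻¹)
    simp only [inv_mul_cancel_right] at this
    omega
  · simpa using (hf 1).1.exists_bound hA hε
  · simpa using (hf 1).2.exists_bound hB hε
  · induction k with
    | zero => simp
    | succ k ih =>
      rw [pow_succ', ← hw] at *
      rw [hstep _ k (by rw [ih, hf1]), ih]
      push_cast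
      ring

end Words

open Filter Topology

/-! ### Homogenisation and rotation numbers -/

section Rotation

theorem eq_zero_of_abs_nat_mul_le {a M : ℝ} (h : ∀ k : ℕ, |(k : ℝ) * a| ≤ M) : a = 0 := by
  by_contra ha
  obtain ⟨k, hk⟩ := exists_nat_gt (M / |a|)
  have := h k
  rw [abs_mul, Nat.abs_cast] at this
  rw [div_lt_iff₀ (abs_pos.2 ha)] at hk
  linarith

variable {G : Type*} [Group G]

theorem abs_map_pow_succ_sub_le {φ : G → ℝ} {D : ℝ} (hφ : ∀ g h, |φ g + φ h - φ (g * h)| ≤ D)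
    (g : G) (k : ℕ) : |φ (g ^ (k + 1)) - (k + 1) * φ g| ≤ k * D := by
  induction k with
  | zero => simp
  | succ k ih =>
    have h := hφ (g ^ (k + 1)) g
    rw [← pow_succ] at h
    rw [abs_le] at *
    push_cast
    constructor <;> nlinarith

/-- Every quasimorphism is at bounded distance from a homogeneous one. -/
theorem exists_homogenization {φ : G → ℝ} {D : ℝ} (hφ : ∀ g h, |φ g + φ h - φ (g * h)| ≤ D) :
    ∃ ψ : G → ℝ, IsHomogeneousQuasimorphism ψ ∧ ∀ g, |ψ g - φ g| ≤ D := by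
  have hD : 0 ≤ D := (abs_nonneg _).trans (hφ 1 1)
  have hlim : ∀ g, ∃ a, Tendsto (fun k : ℕ => φ (g ^ k) / k) atTop (𝓝 a) := fun g => by
    -- Adding the constant `D` makes the sequence subadditive, so Fekete's lemma applies; the
    -- constant disappears in the limit.
    have hsub : Subadditive fun k : ℕ => φ (g ^ k) + D := fun m k => by
      have := (abs_le.1 (hφ (g ^ m) (g ^ k))).1
      rw [← pow_add] at this
      linarith
    have hb : BddBelow (Set.range fun k : ℕ => (φ (g ^ k) + D) / k) := by
      refine ⟨-|φ g| - D, ?_⟩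
      rintro _ ⟨_ | k, rfl⟩
      · simp only [Nat.cast_zero, div_zero]
        linarith [abs_nonneg (φ g)]
      · simp only
        have hk : (0 : ℝ) < ((k + 1 : ℕ) : ℝ) := by positivity
        rw [le_div_iff₀ hk]
        have h1 := (abs_le.1 (abs_map_pow_succ_sub_le hφ g k)).1
        push_cast at *
        have h2 : (k + 1 : ℝ) * φ g ≥ (k + 1) * (-|φ g|) :=
          mul_le_mul_of_nonneg_left (neg_abs_le _) hk.le
        nlinarith
    have h0 : Tendsto (fun k : ℕ => D / (k : ℝ)) atTop (𝓝 0) :=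
      tendsto_const_div_atTop_nhds_zero_nat D
    refine ⟨hsub.lim - 0, ((hsub.tendsto_lim hb).sub h0).congr fun k => ?_⟩
    rw [← sub_div, add_sub_cancel_right]
  choose ψ hψ using hlim
  have hclose : ∀ g, |ψ g - φ g| ≤ D := fun g => by
    have h1 : Tendsto (fun k : ℕ => |φ (g ^ (k + 1)) / ((k + 1 : ℕ) : ℝ) - φ g|) atTop
        (𝓝 |ψ g - φ g|) :=
      (((hψ g).comp (tendsto_add_atTop_nat 1)).sub_const _).abs
    refine le_of_tendsto h1 (Eventually.of_forall fun k => ?_)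
    have hk : (0 : ℝ) < ((k + 1 : ℕ) : ℝ) := by positivity
    have h2 := abs_map_pow_succ_sub_le hφ g k
    have h3 : φ (g ^ (k + 1)) / ((k + 1 : ℕ) : ℝ) - φ g
        = (φ (g ^ (k + 1)) - (k + 1) * φ g) / ((k + 1 : ℕ) : ℝ) := by
      push_cast at *
      field_simp
    rw [h3, abs_div, abs_of_pos hk, div_le_iff₀ hk]
    push_cast
    nlinarith
  have hpow : ∀ g (k : ℕ), ψ (g ^ k) = k * ψ g := fun g k => by
    refine sub_eq_zero.1 ?_
    rcases Nat.eq_zero_or_pos k with rfl | hk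
    · have h1 := hψ 1
      simp only [one_pow] at h1
      have h2 : Tendsto (fun k : ℕ => φ 1 / (k : ℝ)) atTop (𝓝 0) :=
        tendsto_const_div_atTop_nhds_zero_nat _
      simpa using tendsto_nhds_unique h1 h2
    · have h1 : Tendsto (fun m : ℕ => (k : ℝ) * (φ (g ^ (k * m)) / ((k * m : ℕ) : ℝ))) atTop
          (𝓝 (k * ψ g)) :=
        ((hψ g).comp (tendsto_id.const_mul_atTop' hk)).const_mul _
      have h2 : Tendsto (fun m : ℕ => φ ((g ^ k) ^ m) / (m : ℝ)) atTop (𝓝 (k * ψ g)) := by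
        refine h1.congr fun m => ?_
        rw [pow_mul]
        push_cast
        have : (k : ℝ) ≠ 0 := by positivity
        rcases Nat.eq_zero_or_pos m with rfl | hm
        · simp
        · have : (m : ℝ) ≠ 0 := by positivity
          field_simp
      rw [tendsto_nhds_unique (hψ (g ^ k)) h2, sub_self]
  have hinv : ∀ g, ψ g⁻¹ = -ψ g := fun g => by
    have : ψ g⁻¹ + ψ g = 0 := by
      refine eq_zero_of_abs_nat_mul_le (M := 4 * D) fun k => ?_
      rw [mul_add, ← hpow, ← hpow]
      have h1 := abs_le.1 (hclose (g ^ k))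
      have h2 := abs_le.1 (hclose (g⁻¹ ^ k))
      have h3 := abs_le.1 (hφ (g⁻¹ ^ k) (g ^ k))
      have h4 := abs_le.1 (hφ 1 1)
      rw [inv_pow, inv_mul_cancel] at h3
      rw [mul_one] at h4
      rw [inv_pow] at *
      rw [abs_le]
      constructor <;> linarith
    linarith
  refine ⟨ψ, ⟨⟨4 * D, fun g h => ?_⟩, fun g k => ?_⟩, hclose⟩
  · have h1 := abs_le.1 (hclose g)
    have h2 := abs_le.1 (hclose h)
    have h3 := abs_le.1 (hclose (g * h))
    have h4 := abs_le.1 (hφ g h)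
    rw [abs_le]
    constructor <;> linarith
  · obtain ⟨m, rfl | rfl⟩ := k.eq_nat_or_neg
    · rw [zpow_natCast, hpow, Int.cast_natCast]
    · rw [zpow_neg, zpow_natCast, hinv, hpow]
      push_cast
      ring

theorem IsHomogeneousQuasimorphism.map_pow {ψ : G → ℝ} (h : IsHomogeneousQuasimorphism ψ) (g : G)
    (k : ℕ) : ψ (g ^ k) = k * ψ g := by
  simpa using h.map_zpow g k

theorem IsHomogeneousQuasimorphism.map_inv {ψ : G → ℝ} (h : IsHomogeneousQuasimorphism ψ)
    (g : G) : ψ g⁻¹ = -ψ g := by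
  simpa using h.map_zpow g (-1)

/-- Conjugation changes the value on every power by a bounded amount, which homogeneity forces to be
zero. -/
theorem IsHomogeneousQuasimorphism.map_conj {ψ : G → ℝ} (h : IsHomogeneousQuasimorphism ψ)
    (x g : G) : ψ (x * g * x⁻¹) = ψ g := by
  obtain ⟨D, hD⟩ := h.isQuasimorphism
  refine sub_eq_zero.1 (eq_zero_of_abs_nat_mul_le (M := 2 * D) fun k => ?_)
  rw [mul_sub, ← h.map_pow, ← h.map_pow, conj_pow]
  have h1 := abs_le.1 (hD (x * g ^ k) x⁻¹)
  have h2 := abs_le.1 (hD x (g ^ k))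
  rw [h.map_inv] at h1
  rw [abs_le]
  constructor <;> linarith

/-- All left invariant comparisons between the translates of `f` (up to multiples of `n`) are
decided. -/
def HasComparableTranslates (f : G → ℤ) (n : ℤ) : Prop :=
  ∀ u v (m : ℤ), (∀ x, f (x * u) ≤ f (x * v) + m * n) ∨ ∀ x, f (x * v) + m * n ≤ f (x * u)

variable {f : G → ℤ} {n : ℤ}

/-- Take the largest `m` for which the lower bound holds everywhere; comparability turns its failure
at `m + 1` into the upper bound. -/
theorem HasComparableTranslates.exists_between (hf : HasComparableTranslates f n) (hn : 0 < n)
    (u v : G) : ∃ m : ℤ, (∀ x, f (x * v) + m * n ≤ f (x * u)) ∧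
      ∀ x, f (x * u) ≤ f (x * v) + (m + 1) * n := by
  obtain ⟨m, hm, hmax⟩ := Int.exists_greatest_of_bdd
    (P := fun m => ∀ x, f (x * v) + m * n ≤ f (x * u))
    ⟨|f u - f v|, fun m hm => by
      have := hm 1
      simp only [one_mul] at this
      by_contra! h
      have := le_abs_self (f u - f v)
      have := abs_nonneg (f u - f v)
      nlinarith⟩
    ⟨-|f u - f v| - 1, (hf u v _).resolve_left fun h => by
      have := h 1
      simp only [one_mul] at this
      have := neg_abs_le (f u - f v)
      have := abs_nonneg (f u - f v)
      nlinarith⟩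
  refine ⟨m, hm, (hf u v (m + 1)).resolve_right fun h => ?_⟩
  have := hmax _ h
  omega

/-- The increments of `f` under right multiplication by `h` all lie in one interval of length `n`;
compare those at `1` and `g`. -/
theorem HasComparableTranslates.abs_le (hf : HasComparableTranslates f n) (hn : 0 < n) (g h : G) :
    |(f g / n : ℝ) + f h / n - f (g * h) / n| ≤ 1 + |(f 1 : ℝ) / n| := by
  obtain ⟨m, h1, h2⟩ := hf.exists_between hn h 1
  have hn' : (0 : ℝ) < n := by exact_mod_cast hn
  have a1 := h1 1
  have a2 := h1 g
  have b1 := h2 1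
  have b2 := h2 g
  simp only [mul_one, one_mul] at a1 a2 b1 b2
  rify at a1 a2 b1 b2
  have key : |(f g : ℝ) + f h - f (g * h)| ≤ n + |(f 1 : ℝ)| := by
    have := le_abs_self (f 1 : ℝ)
    have := neg_abs_le (f 1 : ℝ)
    rw [_root_.abs_le]
    constructor <;> linarith
  rw [← add_div, ← sub_div, abs_div, abs_div, abs_of_pos hn', div_le_iff₀ hn', add_mul,
    div_mul_cancel₀ _ hn'.ne']
  linarith

/-- The upper envelope of the coordinate `f / n` along the forward orbit of `g`, in the frame moving
with speed `r`. -/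
noncomputable def envelope (f : G → ℤ) (n : ℤ) (r : ℝ) (g v : G) : ℝ :=
  ⨆ k : ℕ, ((f (g ^ k * v) : ℝ) / n - k * r)

/-- The rotation number: the homogenisation of a height function with comparable translates has
defect at most one. -/
theorem HasComparableTranslates.exists_rotation (hf : HasComparableTranslates f n) (hn : 0 < n) :
    ∃ ψ : G → ℝ, IsHomogeneousQuasimorphism ψ ∧ (∀ g h, |ψ g + ψ h - ψ (g * h)| ≤ 1) ∧
      ∃ M, ∀ g, |ψ g - f g / n| ≤ M := by
  obtain ⟨ψ, hψ, hclose⟩ := exists_homogenization (φ := fun g => (f g : ℝ) / n)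
    (hf.abs_le hn)
  have hn' : (0 : ℝ) < n := by exact_mod_cast hn
  set M := 1 + |(f 1 : ℝ) / n| with hM
  have hbdd : ∀ g v, BddAbove (Set.range fun k : ℕ => (f (g ^ k * v) : ℝ) / n - k * ψ g) := by
    intro g v
    refine ⟨2 * M + f v / n, ?_⟩
    rintro _ ⟨k, rfl⟩
    have h1 := _root_.abs_le.1 (hf.abs_le hn (g ^ k) v)
    have h2 := _root_.abs_le.1 (hclose (g ^ k))
    rw [hψ.map_pow] at h2
    simp only at *
    linarith
  let U := fun g v => envelope f n (ψ g) g v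
  have hU : ∀ g v (k : ℕ), (f (g ^ k * v) : ℝ) / n - k * ψ g ≤ U g v := fun g v k =>
    le_ciSup (hbdd g v) k
  -- Replacing `v` by `g * v` drops the first term of the supremum and reindexes the others.
  have hUmul : ∀ g v, U g (g * v) ≤ U g v + ψ g := fun g v => ciSup_le fun k => by
    have := hU g v (k + 1)
    rw [← mul_assoc, ← pow_succ]
    push_cast at this
    linarith
  have hmono : ∀ g u v (m : ℤ), (∀ x, f (x * u) ≤ f (x * v) + m * n) → U g u ≤ U g v + m := by
    intro g u v m h
    refine ciSup_le fun k => ?_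
    have h1 := hU g v k
    have h2 := h (g ^ k)
    rify at h2
    have h3 : (f (g ^ k * u) : ℝ) / n ≤ f (g ^ k * v) / n + m := by
      rw [div_add' _ _ _ hn'.ne']
      gcongr
    linarith
  -- Both differences lie in `[m, m + 1]`, with `m` depending only on `u` and `v`. This is the
  -- source of the defect bound one.
  have hosc : ∀ g h u v, U g u - U g v ≤ U h u - U h v + 1 := fun g h u v => by
    obtain ⟨m, h1, h2⟩ := hf.exists_between hn u v
    have h3 := hmono g u v (m + 1) h2
    have h4 := hmono h v u (-m) fun x => by linarith [h1 x]
    push_cast at h3 h4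
    linarith
  have hstep : ∀ g h v, U g (g * h * v) ≤ U g v + (ψ g + ψ h + 1) := fun g h v => by
    have h1 := hUmul g (h * v)
    have h2 := hUmul h v
    have h3 := hosc g h (h * v) v
    rw [← mul_assoc] at h1
    linarith
  have hiter : ∀ g h (k : ℕ), U g ((g * h) ^ k) ≤ U g 1 + k * (ψ g + ψ h + 1) := fun g h k => by
    induction k with
    | zero => simp
    | succ k ih =>
      have := hstep g h ((g * h) ^ k)
      rw [pow_succ']
      push_cast
      linarith
  -- The envelope along powers of `g * h` grows at rate at most `ψ g + ψ h + 1`, yet it dominates `f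
  -- / n`, which grows at rate `ψ (g * h)`.
  have hle : ∀ g h, ψ (g * h) ≤ ψ g + ψ h + 1 := fun g h => by
    by_contra! hlt
    obtain ⟨k, hk⟩ := exists_nat_gt ((U g 1 + M) / (ψ (g * h) - (ψ g + ψ h + 1)))
    rw [div_lt_iff₀ (by linarith)] at hk
    have h1 := hiter g h k
    have h2 := hU g ((g * h) ^ k) 0
    have h3 := _root_.abs_le.1 (hclose ((g * h) ^ k))
    rw [hψ.map_pow] at h3
    simp only [pow_zero, one_mul, Nat.cast_zero, zero_mul, sub_zero] at h2 h3
    linarith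
  refine ⟨ψ, hψ, fun g h => ?_, M, hclose⟩
  have h1 := hle g h
  have h2 := hle h⁻¹ g⁻¹
  rw [← mul_inv_rev, hψ.map_inv, hψ.map_inv, hψ.map_inv] at h2
  rw [_root_.abs_le]
  constructor <;> linarith

end Rotation

/-! ### Bavard's inequality -/

section Bavard

variable {G : Type*} [Group G] {ψ : G → ℝ}

theorem IsHomogeneousQuasimorphism.map_commutator_le {D : ℝ} (h : IsHomogeneousQuasimorphism ψ)
    (hD : ∀ g h, |ψ g + ψ h - ψ (g * h)| ≤ D) (x y : G) : ψ (x * y * x⁻¹ * y⁻¹) ≤ D := by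
  have h1 := (abs_le.1 (hD x (y * x⁻¹ * y⁻¹))).1
  rw [h.map_conj, h.map_inv] at h1
  rw [show x * y * x⁻¹ * y⁻¹ = x * (y * x⁻¹ * y⁻¹) by group]
  linarith

/-- Each factor costs `D` for its own value and `D` for the multiplication. -/
theorem IsHomogeneousQuasimorphism.map_prod_commutator_le {D : ℝ}
    (h : IsHomogeneousQuasimorphism ψ) (hD : ∀ g h, |ψ g + ψ h - ψ (g * h)| ≤ D)
    (l : List (G × G)) :
    ψ (l.map fun p => p.1 * p.2 * p.1⁻¹ * p.2⁻¹).prod ≤ 2 * D * l.length := by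
  induction l with
  | nil => simpa using (h.map_pow 1 0).le
  | cons p l ih =>
    have h1 := h.map_commutator_le hD p.1 p.2
    have h2 := (abs_le.1 (hD (p.1 * p.2 * p.1⁻¹ * p.2⁻¹)
      (l.map fun p => p.1 * p.2 * p.1⁻¹ * p.2⁻¹).prod)).1
    rw [List.map_cons, List.prod_cons, List.length_cons]
    push_cast
    linarith

theorem IsHomogeneousQuasimorphism.le_scl {D : ℝ}
    (h : IsHomogeneousQuasimorphism ψ) (hD : ∀ g h, |ψ g + ψ h - ψ (g * h)| ≤ D) {g : G}
    (hg : g ∈ commutator G) : ψ g ≤ 2 * D * scl g := by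
  refine ge_of_tendsto ((tendsto_scl hg).const_mul (2 * D)) ?_
  filter_upwards [eventually_gt_atTop 0] with k hk
  obtain ⟨l, hl, hl'⟩ := cl_spec (pow_mem hg k)
  have h1 := h.map_prod_commutator_le hD l
  rw [hl', hl, h.map_pow] at h1
  have hk' : (0 : ℝ) < k := by exact_mod_cast hk
  rw [← mul_div_assoc, le_div_iff₀ hk']
  linarith

end Bavard

/-! ### Dynamical realisation on the line -/

section Shift

variable {X : Type*} [LinearOrder X]

/-- A cofinal order preserving action of the integers on a linear order. -/
structure IsShift (S : ℤ → X → X) (x₀ : X) : Prop where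
  zero : ∀ x, S 0 x = x
  add : ∀ m k x, S (m + k) x = S m (S k x)
  mono : ∀ m, Monotone (S m)
  exists_between : ∀ x, ∃ m, S m x₀ ≤ x ∧ x < S (m + 1) x₀

namespace IsShift

variable {S : ℤ → X → X} {x₀ : X} (h : IsShift S x₀)

include h

theorem neg_apply_self (m : ℤ) (x : X) : S (-m) (S m x) = x := by
  rw [← h.add, neg_add_cancel, h.zero]

theorem strictMono (m : ℤ) : StrictMono (S m) :=
  (h.mono m).strictMono_of_injective fun x y hxy => by
    rw [← h.neg_apply_self m x, hxy, h.neg_apply_self]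

theorem lt_one : x₀ < S 1 x₀ := by
  obtain ⟨m, h1, h2⟩ := h.exists_between x₀
  have := h.strictMono (-m) (h1.trans_lt h2)
  rwa [h.neg_apply_self, ← h.add, neg_add_cancel_left] at this

theorem strictMono_base : StrictMono fun m => S m x₀ :=
  strictMono_int_of_lt_succ fun m => by
    rw [h.add]
    exact h.strictMono m h.lt_one

/-- A countable dense linear order with a cofinal shift is isomorphic to `ℚ` with the integral
translations. -/
theorem exists_orderIso_rat [Countable X] [DenselyOrdered X] :
    ∃ t : X ≃o ℚ, t x₀ = 0 ∧ ∀ m x, t (S m x) = t x + m := by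
  classical
  have : Nonempty (Set.Ioo x₀ (S 1 x₀)) := Set.nonempty_Ioo_subtype h.lt_one
  have : Nonempty (Set.Ioo (0 : ℚ) 1) := Set.nonempty_Ioo_subtype one_pos
  -- Cantor's theorem on the open fundamental interval; the shift then spreads the isomorphism over
  -- the whole order.
  obtain ⟨e⟩ := Order.iso_of_countable_dense (Set.Ioo x₀ (S 1 x₀)) (Set.Ioo (0 : ℚ) 1)
  let u : X → ℚ := fun x => if hx : x ∈ Set.Ioo x₀ (S 1 x₀) then e ⟨x, hx⟩ else 0
  have u0 : u x₀ = 0 := by simp [u]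
  have upos : ∀ x (hx : x ∈ Set.Ioo x₀ (S 1 x₀)), u x = e ⟨x, hx⟩ := fun x hx => dif_pos hx
  have uneg : ∀ x, x ∉ Set.Ioo x₀ (S 1 x₀) → u x = 0 := fun x hx => dif_neg hx
  have unn : ∀ x, 0 ≤ u x := fun x => by
    by_cases hx : x ∈ Set.Ioo x₀ (S 1 x₀)
    · rw [upos x hx]; exact (e ⟨x, hx⟩).2.1.le
    · rw [uneg x hx]
  have ult : ∀ x, u x < 1 := fun x => by
    by_cases hx : x ∈ Set.Ioo x₀ (S 1 x₀)
    · rw [upos x hx]; exact (e ⟨x, hx⟩).2.2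
    · rw [uneg x hx]; exact one_pos
  have umono : ∀ x y, x₀ ≤ x → x < y → y < S 1 x₀ → u x < u y := fun x y h1 h2 h3 => by
    have hy : y ∈ Set.Ioo x₀ (S 1 x₀) := ⟨h1.trans_lt h2, h3⟩
    rcases h1.eq_or_lt with rfl | h1
    · rw [u0, upos y hy]; exact (e ⟨y, hy⟩).2.1
    · have hx : x ∈ Set.Ioo x₀ (S 1 x₀) := ⟨h1, h2.trans h3⟩
      rw [upos x hx, upos y hy]
      exact Subtype.coe_lt_coe.2 (e.strictMono (Subtype.mk_lt_mk.2 h2))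
  have usurj : ∀ q : ℚ, 0 ≤ q → q < 1 → ∃ x, x₀ ≤ x ∧ x < S 1 x₀ ∧ u x = q := fun q h1 h2 => by
    rcases h1.eq_or_lt with rfl | h1
    · exact ⟨x₀, le_rfl, h.lt_one, u0⟩
    · obtain ⟨⟨x, hx⟩, hq⟩ := e.surjective ⟨q, h1, h2⟩
      exact ⟨x, hx.1.le, hx.2, by rw [upos x hx, hq]⟩
  choose fl hfl hfl' using h.exists_between
  have fl_eq : ∀ x m, S m x₀ ≤ x → x < S (m + 1) x₀ → fl x = m := fun x m h1 h2 => by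
    have a1 := h.strictMono_base.lt_iff_lt.1 ((hfl x).trans_lt h2)
    have a2 := h.strictMono_base.lt_iff_lt.1 (h1.trans_lt (hfl' x))
    omega
  have fl_S : ∀ m x, fl (S m x) = m + fl x := fun m x => by
    apply fl_eq
    · rw [h.add]; exact h.mono m (hfl x)
    · rw [add_assoc, h.add]; exact h.strictMono m (hfl' x)
  have rem0 : ∀ x, x₀ ≤ S (-fl x) x := fun x => by
    have := h.mono (-fl x) (hfl x)
    rwa [h.neg_apply_self] at this
  have rem1 : ∀ x, S (-fl x) x < S 1 x₀ := fun x => by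
    have := h.strictMono (-fl x) (hfl' x)
    rwa [← h.add, neg_add_cancel_left] at this
  -- Integer part plus position in the fundamental domain.
  let t : X → ℚ := fun x => fl x + u (S (-fl x) x)
  have tmono : StrictMono t := fun x y hxy => by
    have hle : fl x ≤ fl y := by
      have := h.strictMono_base.lt_iff_lt.1 (((hfl x).trans_lt hxy).trans (hfl' y))
      omega
    rcases hle.eq_or_lt with heq | hlt
    · have := umono _ _ (rem0 x) (h.strictMono (-fl x) hxy) (by rw [heq]; exact rem1 y)
      simp only [t, heq] at this ⊢
      linarith
    · have h1 : (fl x : ℚ) + 1 ≤ fl y := by exact_mod_cast hlt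
      have h2 := ult (S (-fl x) x)
      have h3 := unn (S (-fl y) y)
      simp only [t]
      linarith
  have tS : ∀ m x, t (S m x) = t x + m := fun m x => by
    simp only [t, fl_S]
    rw [← h.add, show -(m + fl x) + m = -fl x by ring]
    push_cast
    ring
  have tsurj : Function.Surjective t := fun q => by
    obtain ⟨x, h1, h2, h3⟩ := usurj (Int.fract q) (Int.fract_nonneg q) (Int.fract_lt_one q)
    have hx : fl x = 0 := fl_eq x 0 (by rwa [h.zero]) (by simpa using h2)
    refine ⟨S ⌊q⌋ x, ?_⟩
    rw [tS]
    simp only [t, hx, neg_zero, h.zero, h3, Int.cast_zero, zero_add]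
    exact Int.fract_add_floor q
  refine ⟨tmono.orderIsoOfSurjective t tsurj, ?_, tS⟩
  have hx : fl x₀ = 0 := fl_eq x₀ 0 (by rw [h.zero]) (by simpa using h.lt_one)
  change t x₀ = 0
  simp [t, hx, h.zero, u0]

/-- Replacing every point by a copy of `ℚ` makes the order dense without losing the shift. -/
theorem prodLex : IsShift (X := X ×ₗ ℚ) (fun m p => toLex (S m (ofLex p).1, (ofLex p).2))
    (toLex (x₀, 0)) where
  zero p := by simp [h.zero]
  add m k p := by simp [h.add]
  mono m p q hpq := by
    rw [Prod.Lex.le_iff] at hpq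
    rw [Prod.Lex.toLex_le_toLex]
    rcases hpq with h1 | ⟨h1, h2⟩
    · exact Or.inl (h.strictMono m h1)
    · exact Or.inr ⟨by simp [h1], h2⟩
  exists_between p := by
    obtain ⟨x, q⟩ := p
    change ∃ m, toLex (S m x₀, (0 : ℚ)) ≤ toLex (x, q) ∧ toLex (x, q) < toLex (S (m + 1) x₀, (0 : ℚ))
    obtain ⟨m, h1, h2⟩ := h.exists_between x
    -- A point over `S m x₀` with negative second coordinate lies below the shifted base point, so
    -- its integer part is `m - 1`.
    by_cases hq : S m x₀ = x ∧ q < 0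
    · refine ⟨m - 1, ?_, ?_⟩
      · rw [Prod.Lex.toLex_le_toLex]
        left
        exact (h.strictMono_base (by omega : m - 1 < m)).trans_le h1
      · rw [Prod.Lex.toLex_lt_toLex]
        right
        simpa using ⟨hq.1.symm, hq.2⟩
    · refine ⟨m, ?_, ?_⟩
      · rw [Prod.Lex.toLex_le_toLex]
        rcases h1.lt_or_eq with h1 | h1
        · exact Or.inl h1
        · exact Or.inr ⟨h1, not_lt.1 fun hq' => hq ⟨h1, hq'⟩⟩
      · rw [Prod.Lex.toLex_lt_toLex]
        exact Or.inl h2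

end IsShift

end Shift

/-! ### Extending order automorphisms of the rationals to the line -/

section Extension

/-- The monotone extension to the line of an order automorphism of the rationals. -/
noncomputable def realExtension (s : ℚ ≃o ℚ) (x : ℝ) : ℝ :=
  sSup ((fun q : ℚ => (s q : ℝ)) '' {q : ℚ | (q : ℝ) ≤ x})

theorem realExtension_bddAbove (s : ℚ ≃o ℚ) (x : ℝ) :
    BddAbove ((fun q : ℚ => (s q : ℝ)) '' {q : ℚ | (q : ℝ) ≤ x}) := by
  obtain ⟨r, hr⟩ := exists_rat_gt x
  refine ⟨s r, ?_⟩
  rintro _ ⟨q, hq, rfl⟩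
  have : q ≤ r := by exact_mod_cast (le_trans hq hr.le)
  exact Rat.cast_le.2 (s.monotone this)

theorem realExtension_monotone (s : ℚ ≃o ℚ) : Monotone (realExtension s) := fun x y hxy => by
  obtain ⟨r, hr⟩ := exists_rat_lt x
  exact csSup_le_csSup (realExtension_bddAbove s y) ⟨_, r, hr.le, rfl⟩
    (Set.image_mono fun q hq => le_trans hq hxy)

@[simp] theorem realExtension_ratCast (s : ℚ ≃o ℚ) (q : ℚ) : realExtension s q = s q := by
  refine IsGreatest.csSup_eq ⟨⟨q, le_refl (q : ℝ), rfl⟩, ?_⟩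
  rintro _ ⟨r, hr, rfl⟩
  have : r ≤ q := by exact_mod_cast hr
  exact Rat.cast_le.2 (s.monotone this)

/-- A monotone function with dense range has no jumps; the range contains `ℚ`. -/
theorem realExtension_continuous (s : ℚ ≃o ℚ) : Continuous (realExtension s) := by
  refine (realExtension_monotone s).continuous_of_denseRange
    ((Rat.denseRange_cast (𝕜 := ℝ)).mono ?_)
  rintro _ ⟨q, rfl⟩
  exact ⟨(s.symm q : ℚ), by simp⟩

theorem realExtension_mul (s s' : ℚ ≃o ℚ) :
    realExtension (s * s') = realExtension s ∘ realExtension s' :=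
  (Rat.denseRange_cast (𝕜 := ℝ)).equalizer (realExtension_continuous _)
    ((realExtension_continuous s).comp (realExtension_continuous s')) (by ext q; simp)

theorem realExtension_one : realExtension 1 = id :=
  (Rat.denseRange_cast (𝕜 := ℝ)).equalizer (realExtension_continuous _) continuous_id
    (by ext q; simp)

/-- The extension of order automorphisms of the rationals to homeomorphisms of the line. -/
noncomputable def realHomeo : (ℚ ≃o ℚ) →* (ℝ ≃ₜ ℝ) where
  toFun s :=
    { toFun := realExtension s
      invFun := realExtension s⁻¹
      left_inv := fun x => by
        rw [← Function.comp_apply (f := realExtension s⁻¹), ← realExtension_mul, inv_mul_cancel,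
          realExtension_one, id]
      right_inv := fun x => by
        rw [← Function.comp_apply (f := realExtension s), ← realExtension_mul, mul_inv_cancel,
          realExtension_one, id]
      continuous_toFun := realExtension_continuous s
      continuous_invFun := realExtension_continuous s⁻¹ }
  map_one' := by
    ext x
    exact congrFun realExtension_one x
  map_mul' s s' := by
    ext x
    exact congrFun (realExtension_mul s s') x

theorem realHomeo_mem_homeoZ {s : ℚ ≃o ℚ} (hs : ∀ (q : ℚ) (m : ℤ), s (q + m) = s q + m) :
    realHomeo s ∈ HomeoZ := by
  refine ⟨(realExtension_monotone s).strictMono_of_injective (realHomeo s).injective,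
    fun x m => ?_⟩
  have := (Rat.denseRange_cast (𝕜 := ℝ)).equalizer (g := fun x : ℝ => realExtension s (x + m))
    (h := fun x => realExtension s x + m)
    ((realExtension_continuous s).comp (continuous_id.add continuous_const))
    ((realExtension_continuous s).add continuous_const) (by
      ext q
      have := realExtension_ratCast s (q + m)
      push_cast at this
      simp [this, hs])
  exact congrFun this x

end Extension

/-- A countable linear order with a cofinal shift has a dynamical realisation: its automorphisms
commuting with the shift act on the line, compatibly with the base points. -/
theorem IsShift.exists_hom_homeoZ {X : Type*} [LinearOrder X] [Countable X] {S : ℤ → X → X}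
    {x₀ : X} (h : IsShift S x₀) {G : Type*} [Group G] (α : G →* (X ≃o X))
    (hα : ∀ g m x, α g (S m x) = S m (α g x)) :
    ∃ F : G →* HomeoZ, ∀ g (m : ℤ), (S m x₀ ≤ α g x₀ → (m : ℝ) ≤ (F g : ℝ ≃ₜ ℝ) 0) ∧
      (α g x₀ ≤ S m x₀ → (F g : ℝ ≃ₜ ℝ) 0 ≤ m) := by
  have : Countable (X ×ₗ ℚ) := inferInstanceAs (Countable (X × ℚ))
  obtain ⟨t, ht0, htS⟩ := h.prodLex.exists_orderIso_rat
  let β : G →* (ℚ ≃o ℚ) :=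
    { toFun := fun g => t.symm.trans ((Prod.Lex.prodLexCongr (α g) (OrderIso.refl ℚ)).trans t)
      map_one' := by
        ext q
        change t (toLex (Prod.map (α 1) id (ofLex (t.symm q)))) = q
        simp
      map_mul' := fun g g' => by
        ext q
        simp [Prod.Lex.prodLexCongr, Prod.map] }
  have hβ : ∀ g (x : X) (q : ℚ), β g (t (toLex (x, q))) = t (toLex (α g x, q)) := fun g x q => by
    simp [β]
  have hβS : ∀ g (q : ℚ) (m : ℤ), β g (q + m) = β g q + m := fun g q m => by
    obtain ⟨⟨x, r⟩, rfl⟩ := t.surjective q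
    have h1 : t (toLex (S m x, r)) = t (toLex (x, r)) + m := htS m (toLex (x, r))
    have h2 : t (toLex (S m (α g x), r)) = t (toLex (α g x, r)) + m := htS m (toLex (α g x, r))
    change β g (t (toLex (x, r)) + m) = β g (t (toLex (x, r))) + m
    rw [← h1, hβ, hβ, ← h2, hα]
  refine ⟨(realHomeo.comp β).codRestrict HomeoZ fun g => realHomeo_mem_homeoZ (hβS g),
    fun g m => ?_⟩
  have hF : ((realHomeo.comp β).codRestrict HomeoZ (fun g => realHomeo_mem_homeoZ (hβS g)) g :
      ℝ ≃ₜ ℝ) 0 = (t (toLex (α g x₀, 0)) : ℚ) := by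
    change realExtension (β g) 0 = _
    have := realExtension_ratCast (β g) (t (toLex (x₀, 0)))
    rw [hβ, ht0] at this
    simpa using this
  have hm : t (toLex (S m x₀, 0)) = m := by
    have := htS m (toLex (x₀, 0))
    rw [ht0, zero_add] at this
    exact this
  rw [hF]
  constructor <;> intro hle
  · have : toLex (S m x₀, (0 : ℚ)) ≤ toLex (α g x₀, 0) := by
      rw [Prod.Lex.toLex_le_toLex']; exact ⟨hle, fun _ => le_rfl⟩
    have := t.monotone this
    rw [hm] at this
    exact_mod_cast this
  · have : toLex (α g x₀, (0 : ℚ)) ≤ toLex (S m x₀, 0) := by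
      rw [Prod.Lex.toLex_le_toLex']; exact ⟨hle, fun _ => le_rfl⟩
    have := t.monotone this
    rw [hm] at this
    exact_mod_cast this

/-! ### Circle actions and the bounded Euler class -/

/-- The circle map covered by an element of `Homeo⁺_ℤ(ℝ)`. -/
noncomputable def circleMap (F : HomeoZ) : UnitAddCircle → UnitAddCircle :=
  Function.Periodic.lift (f := fun x : ℝ => ((F.1 x : ℝ) : UnitAddCircle)) (c := 1) fun x => by
    have := F.2.2 x 1
    rw [Int.cast_one] at this
    simp [this]

@[simp] theorem circleMap_coe (F : HomeoZ) (x : ℝ) :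
    circleMap F (x : UnitAddCircle) = ((F.1 x : ℝ) : UnitAddCircle) := rfl

theorem continuous_circleMap (F : HomeoZ) : Continuous (circleMap F) := by
  rw [(QuotientAddGroup.isQuotientMap_mk (N := AddSubgroup.zmultiples (1 : ℝ))).continuous_iff]
  exact (AddCircle.continuous_mk' 1).comp F.1.continuous

theorem circleMap_mul (F F' : HomeoZ) (x : UnitAddCircle) :
    circleMap (F * F') x = circleMap F (circleMap F' x) := by
  obtain ⟨x, rfl⟩ := QuotientAddGroup.mk_surjective x
  rfl

theorem circleMap_one (x : UnitAddCircle) : circleMap 1 x = x := by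
  obtain ⟨x, rfl⟩ := QuotientAddGroup.mk_surjective x
  rfl

/-- The projection `Homeo⁺_ℤ(ℝ) → Homeo⁺(S¹)`. -/
noncomputable def toHomeoCircle : HomeoZ →* HomeoCircle where
  toFun F := ⟨{
    toFun := circleMap F
    invFun := circleMap F⁻¹
    left_inv := fun x => by rw [← circleMap_mul, inv_mul_cancel, circleMap_one]
    right_inv := fun x => by rw [← circleMap_mul, mul_inv_cancel, circleMap_one]
    continuous_toFun := continuous_circleMap F
    continuous_invFun := continuous_circleMap F⁻¹ }, F.1, F.2, fun _ => rfl⟩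
  map_one' := Subtype.ext (Homeomorph.ext circleMap_one)
  map_mul' F F' := Subtype.ext (Homeomorph.ext (circleMap_mul F F'))

theorem isLift_toHomeoCircle (F : HomeoZ) : IsLift F.1 (toHomeoCircle F).1 := fun _ => rfl

theorem apply_eq_boundedLift_add (F : HomeoZ) (x : ℝ) :
    F.1 x = boundedLift (toHomeoCircle F) x + ⌊F.1 0⌋ := by
  obtain ⟨-, h, h0⟩ := boundedLift_spec (toHomeoCircle F)
  obtain ⟨m, hm⟩ := lift_unique (isLift_toHomeoCircle F) h
  have : ⌊F.1 0⌋ = m := by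
    rw [Int.floor_eq_iff, hm]
    constructor <;> linarith [h0.1, h0.2]
  rw [this, hm]

/-- `F` differs from the bounded lift by the translation `⌊F 0⌋`. Thus the Euler cocycle is minus
the coboundary of this floor, whence the sign in the Euler class statement. -/
theorem eulerCocycle_toHomeoCircle (F F' : HomeoZ) :
    eulerCocycle (toHomeoCircle F) (toHomeoCircle F') =
      ⌊(F * F').1 0⌋ - ⌊F.1 0⌋ - ⌊F'.1 0⌋ := by
  have h1 := eulerCocycle_spec (toHomeoCircle F) (toHomeoCircle F') 0
  have h2 := apply_eq_boundedLift_add (F * F') 0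
  have h3 := apply_eq_boundedLift_add F (F'.1 0)
  rw [apply_eq_boundedLift_add F' 0, (boundedLift_spec (toHomeoCircle F)).1.2,
    ← apply_eq_boundedLift_add F' 0, h1, ← map_mul] at h3
  change F.1 (F'.1 0) = _ at h2
  have : (eulerCocycle (toHomeoCircle F) (toHomeoCircle F') : ℝ) =
      ⌊(F * F').1 0⌋ - ⌊F.1 0⌋ - ⌊F'.1 0⌋ := by linarith
  exact_mod_cast this

/-- If a quasimorphism is at bounded distance from the displacement of an action on the line, then
its negative represents the real bounded Euler class of the induced circle action. -/
theorem quasimorphismClass_eq_pullback {G : Type*} [Group G] (F : G →* HomeoZ) {φ : G → ℝ}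
    (hφ : IsQuasimorphism φ) {M : ℝ} (hM : ∀ g, |φ g + (F g).1 0| ≤ M) :
    quasimorphismClass φ hφ = H2b.pullback (toHomeoCircle.comp F) realBoundedEulerClass := by
  refine QuotientAddGroup.eq.2 ?_
  refine ⟨fun g => -φ g - ⌊(F g).1 0⌋, ⟨M + 1, fun g => ?_⟩, ?_⟩
  · have h1 := abs_le.1 (hM g)
    have h2 := Int.floor_le ((F g).1 0)
    have h3 := Int.lt_floor_add_one ((F g).1 0)
    rw [Real.norm_eq_abs, abs_le]
    constructor <;> linarith
  · ext g h
    have := eulerCocycle_toHomeoCircle (F g) (F h)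
    rw [← map_mul] at this
    change _ = -(φ h - φ (g * h) + φ g) +
      ((eulerCocycle (toHomeoCircle (F g)) (toHomeoCircle (F h)) : ℤ) : ℝ)
    rw [this]
    simp only [coboundary, AddMonoidHom.coe_mk, ZeroHom.coe_mk]
    push_cast
    ring

/-! ### The ordered set of translates and its dynamical realisation -/

section Translates

variable {G : Type*} [Group G] {f : G → ℤ} {n : ℤ}

/-- The translates of `f`, up to multiples of `n`. -/
def Translates (f : G → ℤ) (n : ℤ) : Type _ :=
  Set.range fun p : G × ℤ => fun x => f (x * p.1) + p.2 * n

instance [Countable G] : Countable (Translates f n) :=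
  (Set.countable_range _).to_subtype

/-- The pointwise order on translates. -/
noncomputable abbrev HasComparableTranslates.linearOrder (hf : HasComparableTranslates f n) :
    LinearOrder (Translates f n) :=
  { (inferInstanceAs (PartialOrder (Set.range fun p : G × ℤ => fun x => f (x * p.1) + p.2 * n)) :
      PartialOrder (Translates f n)) with
    le_total := by
      rintro ⟨_, ⟨u, k⟩, rfl⟩ ⟨_, ⟨v, m⟩, rfl⟩
      rcases hf u v (m - k) with h | h
      · left
        intro x
        have := h x
        change f (x * u) + k * n ≤ f (x * v) + m * n
        linarith
      · right
        intro x
        have := h x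
        change f (x * v) + m * n ≤ f (x * u) + k * n
        linarith
    toDecidableLE := Classical.decRel _ }

/-- Right translation of functions. -/
def Translates.translate (g : G) (u : Translates f n) : Translates f n :=
  ⟨fun x => u.1 (x * g), by
    obtain ⟨⟨v, m⟩, hv⟩ := u.2
    exact ⟨(g * v, m), by rw [← hv]; ext x; simp [mul_assoc]⟩⟩

/-- Addition of multiples of `n`. -/
def Translates.shift (k : ℤ) (u : Translates f n) : Translates f n :=
  ⟨fun x => u.1 x + k * n, by
    obtain ⟨⟨v, m⟩, hv⟩ := u.2
    exact ⟨(v, m + k), by rw [← hv]; ext x; ring⟩⟩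

/-- The function `f` itself, as one of its translates. -/
def Translates.base (f : G → ℤ) (n : ℤ) : Translates f n :=
  ⟨f, (1, 0), by ext x; simp⟩

/-- A countable group with a height function with comparable translates acts on the line by
homeomorphisms commuting with integral translations, with displacement close to the height. -/
theorem HasComparableTranslates.exists_hom_homeoZ [Countable G] (hf : HasComparableTranslates f n)
    (hn : 0 < n) :
    ∃ (F : G →* HomeoZ) (M : ℝ), ∀ g, |(F g).1 0 - f g / n| ≤ M := by
  let := hf.linearOrder
  have hS : IsShift (Translates.shift (f := f) (n := n)) (Translates.base f n) :=
    { zero := fun u => Subtype.ext (funext fun x => by simp [Translates.shift])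
      add := fun m k u => Subtype.ext (funext fun x => by simp [Translates.shift]; ring)
      mono := fun m u v h x => add_le_add_left (h x) _
      exists_between := by
        rintro ⟨_, ⟨u, k⟩, rfl⟩
        obtain ⟨m, h1, h2⟩ := hf.exists_between hn u 1
        have hle : Translates.shift (m + k) (Translates.base f n) ≤
            ⟨fun x => f (x * u) + k * n, ⟨(u, k), rfl⟩⟩ := fun x => by
          have := h1 x
          rw [mul_one] at this
          change f x + (m + k) * n ≤ f (x * u) + k * n
          linarith
        have hge : ⟨fun x => f (x * u) + k * n, ⟨(u, k), rfl⟩⟩ ≤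
            Translates.shift (m + k + 1) (Translates.base f n) := fun x => by
          have := h2 x
          rw [mul_one] at this
          change f (x * u) + k * n ≤ f x + (m + k + 1) * n
          linarith
        have hlt : ∀ i, Translates.shift i (Translates.base f n) <
            Translates.shift (i + 1) (Translates.base f n) := fun i => by
          rw [lt_iff_le_not_ge]
          refine ⟨fun x => ?_, fun h => ?_⟩
          · change f x + i * n ≤ f x + (i + 1) * n
            linarith
          · have : f 1 + (i + 1) * n ≤ f 1 + i * n := h 1
            linarith
        -- If the upper bound is attained, the function is itself a shift of the base, and the index
        -- increases by one.
        rcases hge.lt_or_eq with h | h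
        · exact ⟨m + k, hle, h⟩
        · exact ⟨m + k + 1, h.ge, h.trans_lt (hlt _)⟩ }
  let α : G →* (Translates f n ≃o Translates f n) :=
    { toFun := fun g =>
        { toFun := Translates.translate g
          invFun := Translates.translate g⁻¹
          left_inv := fun u => Subtype.ext (funext fun x => by simp [Translates.translate])
          right_inv := fun u => Subtype.ext (funext fun x => by simp [Translates.translate])
          map_rel_iff' := by
            intro u v
            refine ⟨fun h x => ?_, fun h x => h (x * g)⟩
            have : u.1 (x * g⁻¹ * g) ≤ v.1 (x * g⁻¹ * g) := h (x * g⁻¹)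
            simpa only [inv_mul_cancel_right] using this }
      map_one' := by
        ext u
        exact Subtype.ext (funext fun x => by simp [Translates.translate])
      map_mul' := fun g h => by
        ext u
        exact Subtype.ext (funext fun x => congrArg u.1 (mul_assoc x g h).symm) }
  obtain ⟨F, hF⟩ := hS.exists_hom_homeoZ α fun g m u => rfl
  -- The displacement of `0` and `(f g - f 1) / n` lie in the same interval `[m, m + 1]`.
  refine ⟨F, 1 + |(f 1 : ℝ) / n|, fun g => ?_⟩
  obtain ⟨m, h1, h2⟩ := hf.exists_between hn g 1
  simp only [mul_one] at h1 h2
  have b1 := (hF g m).1 h1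
  have b2 := (hF g (m + 1)).2 h2
  have a1 := h1 1
  have a2 := h2 1
  have hn' : (0 : ℝ) < n := by exact_mod_cast hn
  simp only [one_mul] at a1 a2
  rify at a1 a2
  have c1 : (f 1 : ℝ) / n + m ≤ f g / n := by
    rw [div_add' _ _ _ hn'.ne']; gcongr
  have c2 : (f g : ℝ) / n ≤ f 1 / n + (m + 1) := by
    rw [div_add' _ _ _ hn'.ne']; gcongr
  have := le_abs_self ((f 1 : ℝ) / n)
  have := neg_abs_le ((f 1 : ℝ) / n)
  push_cast at b2
  rw [_root_.abs_le]
  constructor <;> linarith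

end Translates

theorem IsHomogeneousQuasimorphism.eq_zero_of_bounded {G K : Type*} [Group G] [Group K]
    {ψ : G → ℝ} (h : IsHomogeneousQuasimorphism ψ) (ι : K →* G) {M : ℝ}
    (hM : ∀ a, |ψ (ι a)| ≤ M) (a : K) : ψ (ι a) = 0 :=
  eq_zero_of_abs_nat_mul_le fun k => by
    rw [← h.map_pow, ← _root_.map_pow]
    exact hM _

theorem IsHomogeneousQuasimorphism.neg {G : Type*} [Group G] {ψ : G → ℝ}
    (h : IsHomogeneousQuasimorphism ψ) : IsHomogeneousQuasimorphism (-ψ) where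
  isQuasimorphism := by
    obtain ⟨D, hD⟩ := h.isQuasimorphism
    refine ⟨D, fun g h => ?_⟩
    rw [← abs_neg]
    convert hD g h using 2
    simp only [Pi.neg_apply]
    ring
  map_zpow g k := by simp [h.map_zpow]

theorem defect_le {G : Type*} [Group G] {φ : G → ℝ} {D : ℝ}
    (h : ∀ g h, |φ g + φ h - φ (g * h)| ≤ D) : defect φ ≤ D :=
  csInf_le ⟨0, fun _ hE => (abs_nonneg _).trans (hE 1 1)⟩ h

end AmalgamScl

/-! ### Conclusion -/

theorem theorem6p3 {A B C : Type*} [Group A] [Group B] [Group C]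
    (κA : C →* A) (κB : C →* B)
    (hκA : Function.Injective κA) (hκB : Function.Injective κB)
    (hA : LeftRelativelyConvex κA.range) (hB : LeftRelativelyConvex κB.range)
    (g₀ : Amalgam κA κB)
    (hgA : ∀ (x : Amalgam κA κB) (a : A), x * g₀ * x⁻¹ ≠ Amalgam.inl κA κB a)
    (hgB : ∀ (x : Amalgam κA κB) (b : B), x * g₀ * x⁻¹ ≠ Amalgam.inr κA κB b) :
    (∃ (φ : Amalgam κA κB → ℝ) (hφ : IsHomogeneousQuasimorphism φ),
      1 ≤ φ g₀ ∧ defect φ ≤ 1 ∧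
      (∀ a : A, φ (Amalgam.inl κA κB a) = 0) ∧
      (∀ b : B, φ (Amalgam.inr κA κB b) = 0) ∧
      (Countable (Amalgam κA κB) →
        ∃ ρ : Amalgam κA κB →* HomeoCircle,
          quasimorphismClass φ hφ.isQuasimorphism = H2b.pullback ρ realBoundedEulerClass)) ∧
    (g₀ ∈ commutator (Amalgam κA κB) → 1 / 2 ≤ scl g₀) := by
  -- The Euler class is represented by minus the rotation number, so the height is made to grow
  -- along `g₀⁻¹` and `-ψ` is used.
  obtain ⟨f, n, hn, hf, ⟨MA, hMA⟩, ⟨MB, hMB⟩, x, hx⟩ := exists_height_function hκA hκB hA hB g₀⁻¹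
    (fun x a h => hgA x a⁻¹ (by rw [map_inv, ← h]; group))
    (fun x b h => hgB x b⁻¹ (by rw [map_inv, ← h]; group))
  have hf : HasComparableTranslates f n := hf
  obtain ⟨ψ, hψ, hD, M, hM⟩ := hf.exists_rotation hn
  have hn' : (0 : ℝ) < n := by exact_mod_cast hn
  have hbound : ∀ g (N : ℤ), |f g| ≤ N → |ψ g| ≤ M + N / n := fun g N hN => by
    have h1 := abs_sub_abs_le_abs_sub (ψ g) (f g / n)
    have h2 : |(f g : ℝ) / n| ≤ N / n := by
      rw [abs_div, abs_of_pos hn']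
      gcongr
      exact_mod_cast hN
    linarith [hM g]
  -- On powers of the conjugate of `g₀⁻¹` the height is exactly `f 1 + k * n`, so its rotation
  -- number is exactly one.
  have hg₀ : (-ψ) g₀ = 1 := by
    rw [Pi.neg_apply, ← hψ.map_inv, ← hψ.map_conj x]
    refine sub_eq_zero.1 (eq_zero_of_abs_nat_mul_le (M := M + |(f 1 : ℝ) / n|) fun k => ?_)
    have h1 := hM ((x * g₀⁻¹ * x⁻¹) ^ k)
    rw [hψ.map_pow, hx] at h1
    push_cast at h1
    rw [add_div, mul_div_cancel_right₀ _ hn'.ne'] at h1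
    rw [mul_sub, mul_one]
    have h2 := abs_add_le (k * ψ (x * g₀⁻¹ * x⁻¹) - (f 1 / n + k)) (f 1 / n)
    rw [show (k * ψ (x * g₀⁻¹ * x⁻¹) - (f 1 / n + k)) + f 1 / n =
      k * ψ (x * g₀⁻¹ * x⁻¹) - k by ring] at h2
    linarith
  have hD' : ∀ g h, |(-ψ) g + (-ψ) h - (-ψ) (g * h)| ≤ 1 := fun g h => by
    rw [← abs_neg]
    convert hD g h using 2
    simp only [Pi.neg_apply]
    ring
  refine ⟨⟨-ψ, hψ.neg, hg₀.ge, defect_le hD', fun a => ?_, fun b => ?_, fun _ => ?_⟩, fun hg => ?_⟩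
  · rw [Pi.neg_apply, hψ.eq_zero_of_bounded _ (fun a => hbound _ _ (hMA a)), neg_zero]
  · rw [Pi.neg_apply, hψ.eq_zero_of_bounded _ (fun b => hbound _ _ (hMB b)), neg_zero]
  · obtain ⟨F, M', hF⟩ := hf.exists_hom_homeoZ hn
    refine ⟨toHomeoCircle.comp F, quasimorphismClass_eq_pullback F _ (M := M' + M) fun g => ?_⟩
    have h1 := abs_le.1 (hF g)
    have h2 := abs_le.1 (hM g)
    rw [Pi.neg_apply, abs_le]
    constructor <;> linarith
  · have := hψ.neg.le_scl hD' hg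
    rw [hg₀] at this
    linarith
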